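/- **Setting.** Let $n,\nu,m_1,m_2,p_1,p_2$ be even, and let $m=m_1+m_2$. Put $\mathbf J=\begin{bmatrix}0&1\\-1&0\end{bmatrix}$, $J_k=I_{m_k/2}\otimes\mathbf J$, $J=\operatorname{diag}(J_1,J_2)$, $\Omega=I_m+iJ$ and $S=\sqrt{\Omega^{T}}=\tfrac1{\sqrt2}\Omega^{T}$. Fixed data: real nonsingular antisymmetric matrices $\Theta_1\in\mathbb R^{n\times n}$, $\Theta_2\in\mathbb R^{\nu\times\nu}$, with $\Theta=\operatorname{diag}(\Theta_1,\Theta_2)$; real matrices $R_1=R_1^T\in\mathbb R^{n\times n}$, $M_1\in\mathbb R^{m_1\times n}$, $L_1\in\mathbb R^{p_2\times n}$; matrices $D\in\mathbb R^{p_1\times m_1}$, $d\in\mathbb R^{p_2\times m_2}$ formed from conjugate pairs of rows of permutation matrices (that is, $D$, $d$ select $p_1/2$, $p_2/2$ distinct conjugate pairs of channels), so that $\widetilde J_1=DJ_1D^T=I_{p_1/2}\otimes\mathbf J$ and $\widetilde J_2=dJ_2d^T=I_{p_2/2}\otimes\mathbf J$; and weights $N\in\mathbb R^{r\times n}$, $K\in\mathbb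 R^{r\times p_2}$. The plant has $$A=2\Theta_1(R_1+M_1^TJ_1M_1+L_1^T\widetilde J_2L_1),\quad B=2\Theta_1M_1^T,\quad C=2DJ_1M_1,\quad E=2\Theta_1L_1^T .$$ A coherent quantum controller is given by a triple $\mathcal E=(R_2,M_2,L_2)$ with $R_2=R_2^T\in\mathbb R^{\nu\times\nu}$, $M_2\in\mathbb R^{m_2\times\nu}$, $L_2\in\mathbb R^{p_1\times\nu}$, through $$a=2\Theta_2(R_2+M_2^TJ_2M_2+L_2^T\widetilde J_1L_2),\quad b=2\Theta_2M_2^T,\quad c=2dJ_2M_2,\quad e=2\Theta_2L_2^T ,$$ and the closed-loop system has $$\mathcal A=\begin{bmatrix}A&Ec\\eC&a\end{bmatrix},\quad \mathcal B=\begin{bmatrix}B&Ed\\eD&b\end{bmatrix},\quad \mathcal C=\begin{bmatrix}N&Kc\end{bmatrix},\quad F(s)=\mathcal C(sI-\mathcal A)^{-1}\mathcal B .$$ Write $F=F(i\lambda)$, $\Phi=FF^*$, $\Psi=FJF^*$ for $\lambda\in\mathbb R$. For $\theta>0$ the risk-sensitive cost is the growth rate of the quadratic-exponential functional, in its frequency-domain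 form $$\Upsilon_\theta=-\frac1{4\pi}\int_{\mathbb R}\ln\det D_\theta(\lambda)\,d\lambda,\qquad D_\theta=\cos(\theta\Psi)-\theta\,\Phi\operatorname{sinc}(\theta\Psi).$$ The controller is *admissible* if (i) $\mathcal A$ is Hurwitz; (ii) for all sufficiently large $T>0$ the integral operator $f\mapsto\int_0^T\Lambda(\cdot-t)f(t)\,dt$ on $L^2([0,T],\mathbb C^r)$ is injective, where $\Lambda(\tau)=\mathcal C e^{\tau\mathcal A}\Theta\,\mathcal C^T$ for $\tau\ge0$ and $\Lambda(\tau)=\mathcal C\Theta e^{-\tau\mathcal A^T}\mathcal C^T$ for $\tau<0$; (iii) $\theta\sup_{\lambda}\lambda_{\max}\big(\Phi(\lambda)\operatorname{tanc}(\theta\Psi(\lambda))\big)<1$, where $\operatorname{tanc}z=\tan z/z$. With $\phi(u)=(e^u-1)/u$, let $\Delta_\theta=I_m-\theta\,SF^*\phi(2i\theta\Psi)FS$, let $\varpi_\theta$ be the bottom-left $r\times r$ block of $\phi\left(\begin{bmatrix}2i\theta\Psi&0\\FS\Delta_\theta^{-1}SF^*&2i\theta\Psi\end{bmatrix}\right)$,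 and let $\mathfrak M_{\theta,F}$ be the frequency-dependent operator on $\mathbb C^{r\times m}$ $$\mathfrak M_{\theta,F}(X)=\phi(2i\theta\Psi)\,X\,S\Delta_\theta^{-1}S+\varpi_\theta\,X\,(2i\theta J).$$ For a fixed frequency-dependent operator $\mathfrak M$, the weighted coherent quantum LQG cost is $$V=\frac1{4\pi}\int_{\mathbb R}\langle F,\mathfrak M(F)\rangle\,d\lambda,\qquad\langle X,Y\rangle=\operatorname{Tr}(X^*Y).$$ A controller is a *stationary point* of the problem with cost $\Upsilon$ (one of $\Upsilon_\theta$, $V$, regarded as a function of $(\mathcal A,\mathcal B,\mathcal C)$) if $$\mathbf S(\Theta_2\,\partial_a\Upsilon)=0,\qquad 2J_2M_2\mathbf A(\Theta_2\,\partial_a\Upsilon)+\partial_b\Upsilon^T\Theta_2-J_2d^T\partial_c\Upsilon=0,\qquad 2\widetilde J_1L_2\mathbf A(\Theta_2\,\partial_a\Upsilon)+\partial_e\Upsilon^T\Theta_2=0,$$ where $\mathbf S(\mu)=\frac12(\mu+\mu^T)$, $\mathbf A(\mu)=\frac12(\mu-\mu^T)$ and $\partial_a,\partial_b,\partial_c,\partial_e$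 are the partial Fréchet derivatives (Frobenius gradients) with respect to $a,b,c,e$ as independent variables. **Theorem.** Let $\theta>0$, let $\mathcal E$ be an admissible controller with closed-loop transfer function $F_*$, and fix $\mathfrak M:=\mathfrak M_{\theta,F_*}$. Then $\mathfrak M$ is self-adjoint at every frequency and its operator norm is bounded uniformly over the frequency. The integrals defining $\Upsilon_\theta$ and $V$ converge for all $(\mathcal A,\mathcal B,\mathcal C)$ near those of the closed-loop system; $\Upsilon_\theta$ and $V$ are Fréchet differentiable functions of $(\mathcal A,\mathcal B,\mathcal C)$ there; and their core matrices coincide: $$\theta^{-1}\,\partial_{\mathcal A,\mathcal B,\mathcal C}\Upsilon_\theta=\partial_{\mathcal A,\mathcal B,\mathcal C}V .$$ The controller is a stationary point of the risk-sensitive problem $\Upsilon_\theta\to\inf$ if and only if it is a stationary point of the weighted coherent quantum LQG problem $V\to\inf$. Likewise, the Fréchet derivative of $\mathcal E\mapsto\Upsilon_\theta$ vanishes at the controller if and only if that of $\mathcal E\mapsto V$ does. -/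

import Mathlib

open scoped Matrix Kronecker Topology
open MeasureTheory Filter

noncomputable section

namespace CQRS

/-! ### Quantum fields -/

/-- Index set of a quantum field with `2 * k` channels, organised into `k` conjugate pairs. -/
abbrev FieldIdx (k : ℕ) : Type := Fin k × Fin 2

/-- Index set of the combined external noise of the plant and the controller. -/
abbrev NoiseIdx (k₁ k₂ : ℕ) : Type := FieldIdx k₁ ⊕ FieldIdx k₂

/-- The commutation matrix of a field, block-diagonal with `k` blocks `[[0, 1], [-1, 0]]`. -/
def fieldJ (k : ℕ) : Matrix (FieldIdx k) (FieldIdx k) ℝ :=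
  (1 : Matrix (Fin k) (Fin k) ℝ) ⊗ₖ !![0, 1; -1, 0]

/-- The commutation matrix `J` of the combined external noise. -/
def noiseJ (k₁ k₂ : ℕ) : Matrix (NoiseIdx k₁ k₂) (NoiseIdx k₁ k₂) ℝ :=
  Matrix.fromBlocks (fieldJ k₁) 0 0 (fieldJ k₂)

/-- The real matrix `J` regarded as a complex one. -/
def noiseJC (k₁ k₂ : ℕ) : Matrix (NoiseIdx k₁ k₂) (NoiseIdx k₁ k₂) ℂ :=
  (noiseJ k₁ k₂).map Complex.ofReal

/-- The quantum Ito matrix `Ω = I + i J`. -/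
def itoMatrix (k₁ k₂ : ℕ) : Matrix (NoiseIdx k₁ k₂) (NoiseIdx k₁ k₂) ℂ :=
  1 + Complex.I • noiseJC k₁ k₂

/-- `S = Ωᵀ / √2`; it is the positive semi-definite square root of `Ωᵀ`. -/
def itoRoot (k₁ k₂ : ℕ) : Matrix (NoiseIdx k₁ k₂) (NoiseIdx k₁ k₂) ℂ :=
  ((1 / Real.sqrt 2 : ℝ) : ℂ) • (itoMatrix k₁ k₂)ᵀ

/-- Feedthrough matrix of an oscillator whose output consists of the conjugate pairs number
`σ 0, σ 1, …` of its input channels: `q` conjugate pairs of rows of a permutation matrix. -/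
def feedthrough {k q : ℕ} (σ : Fin q ↪ Fin k) : Matrix (FieldIdx q) (FieldIdx k) ℝ :=
  Matrix.of fun i j => if σ i.1 = j.1 ∧ i.2 = j.2 then 1 else 0

/-! ### Plant, controller and closed-loop system -/

/-- The fixed data of the control problem: a quantum plant with `n` variables, the commutation
and feedthrough matrices of a controller with `ν` variables, and the weights of the criterion
process. The external noises of plant and controller have `2 * k₁` and `2 * k₂` channels, their
outputs have `2 * q₁` and `2 * q₂` channels, and the criterion process has `r` components. -/
structure Setup (n ν k₁ k₂ q₁ q₂ r : ℕ) where
  /-- commutation matrix of the plant variables -/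
  Θ₁ : Matrix (Fin n) (Fin n) ℝ
  Θ₁_antisymm : Θ₁ᵀ = -Θ₁
  Θ₁_det : Θ₁.det ≠ 0
  /-- commutation matrix of the controller variables -/
  Θ₂ : Matrix (Fin ν) (Fin ν) ℝ
  Θ₂_antisymm : Θ₂ᵀ = -Θ₂
  Θ₂_det : Θ₂.det ≠ 0
  /-- energy matrix of the plant -/
  R₁ : Matrix (Fin n) (Fin n) ℝ
  R₁_symm : R₁ᵀ = R₁
  /-- coupling of the plant to its external noise -/
  M₁ : Matrix (FieldIdx k₁) (Fin n) ℝ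
  /-- coupling of the plant to the controller output -/
  L₁ : Matrix (FieldIdx q₂) (Fin n) ℝ
  /-- the selection of plant noise channels in the plant output -/
  σ₁ : Fin q₁ ↪ Fin k₁
  /-- the selection of controller noise channels in the controller output -/
  σ₂ : Fin q₂ ↪ Fin k₂
  /-- weight of the plant variables in the criterion process -/
  N : Matrix (Fin r) (Fin n) ℝ
  /-- weight of the controller output drift in the criterion process -/
  K : Matrix (Fin r) (FieldIdx q₂) ℝ

/-- The space of real symmetric matrices. -/
def symMat (ν : ℕ) : Submodule ℝ (Matrix (Fin ν) (Fin ν) ℝ) where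
  carrier := {R | Rᵀ = R}
  add_mem' := by
    intro a b ha hb
    change _ᵀ = _ at ha hb ⊢
    rw [Matrix.transpose_add, ha, hb]
  zero_mem' := by simp
  smul_mem' := by
    intro c a ha
    change _ᵀ = _ at ha ⊢
    rw [Matrix.transpose_smul, ha]

/-- The space of triples `(R₂, M₂, L₂)`: energy matrix of the controller and its couplings to
its external noise and to the plant output. -/
abbrev Energetics (ν k₂ q₁ : ℕ) : Type :=
  symMat ν × Matrix (FieldIdx k₂) (Fin ν) ℝ × Matrix (FieldIdx q₁) (Fin ν) ℝ

/-- The space of quadruples `(a, b, c, e)` of controller matrices. -/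
abbrev CtrlMatrices (ν k₂ q₁ q₂ : ℕ) : Type :=
  Matrix (Fin ν) (Fin ν) ℝ × Matrix (Fin ν) (FieldIdx k₂) ℝ ×
    Matrix (FieldIdx q₂) (Fin ν) ℝ × Matrix (Fin ν) (FieldIdx q₁) ℝ

/-- The space of triples `(𝒜, ℬ, 𝒞)` of closed-loop system matrices. -/
abbrev LoopMatrices (n ν k₁ k₂ r : ℕ) : Type :=
  Matrix (Fin n ⊕ Fin ν) (Fin n ⊕ Fin ν) ℝ × Matrix (Fin n ⊕ Fin ν) (NoiseIdx k₁ k₂) ℝ ×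
    Matrix (Fin r) (Fin n ⊕ Fin ν) ℝ

namespace Setup

variable {n ν k₁ k₂ q₁ q₂ r : ℕ} (P : Setup n ν k₁ k₂ q₁ q₂ r)

/-- plant feedthrough -/
def D : Matrix (FieldIdx q₁) (FieldIdx k₁) ℝ := feedthrough P.σ₁

/-- controller feedthrough -/
def d : Matrix (FieldIdx q₂) (FieldIdx k₂) ℝ := feedthrough P.σ₂

/-- commutation matrix of the plant output field -/
def Jt₁ : Matrix (FieldIdx q₁) (FieldIdx q₁) ℝ := P.D * fieldJ k₁ * P.Dᵀ

/-- commutation matrix of the controller output field -/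
def Jt₂ : Matrix (FieldIdx q₂) (FieldIdx q₂) ℝ := P.d * fieldJ k₂ * P.dᵀ

def A : Matrix (Fin n) (Fin n) ℝ :=
  (2 : ℝ) • (P.Θ₁ * (P.R₁ + P.M₁ᵀ * fieldJ k₁ * P.M₁ + P.L₁ᵀ * P.Jt₂ * P.L₁))

def B : Matrix (Fin n) (FieldIdx k₁) ℝ := (2 : ℝ) • (P.Θ₁ * P.M₁ᵀ)

def C : Matrix (FieldIdx q₁) (Fin n) ℝ := (2 : ℝ) • (P.D * fieldJ k₁ * P.M₁)

def E : Matrix (Fin n) (FieldIdx q₂) ℝ := (2 : ℝ) • (P.Θ₁ * P.L₁ᵀ)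

/-- Commutation matrix of the closed-loop system variables. -/
def Θ : Matrix (Fin n ⊕ Fin ν) (Fin n ⊕ Fin ν) ℝ := Matrix.fromBlocks P.Θ₁ 0 0 P.Θ₂

/-- The controller matrices `(a, b, c, e)` of a physically realizable controller with given
energy and coupling matrices `(R₂, M₂, L₂)`. -/
def ctrl (ε : Energetics ν k₂ q₁) : CtrlMatrices ν k₂ q₁ q₂ :=
  ((2 : ℝ) • (P.Θ₂ * ((ε.1 : Matrix (Fin ν) (Fin ν) ℝ) + ε.2.1ᵀ * fieldJ k₂ * ε.2.1
      + ε.2.2ᵀ * P.Jt₁ * ε.2.2)),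
    (2 : ℝ) • (P.Θ₂ * ε.2.1ᵀ),
    (2 : ℝ) • (P.d * fieldJ k₂ * ε.2.1),
    (2 : ℝ) • (P.Θ₂ * ε.2.2ᵀ))

/-- The closed-loop system matrices `(𝒜, ℬ, 𝒞)` for given controller matrices `(a, b, c, e)`. -/
def loop (γ : CtrlMatrices ν k₂ q₁ q₂) : LoopMatrices n ν k₁ k₂ r :=
  (Matrix.fromBlocks P.A (P.E * γ.2.2.1) (γ.2.2.2 * P.C) γ.1,
    Matrix.fromBlocks P.B (P.E * P.d) (γ.2.2.2 * P.D) γ.2.1,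
    Matrix.fromCols P.N (P.K * γ.2.2.1))

/-- The closed-loop system matrices for given controller energy and coupling matrices. -/
def closedLoop (ε : Energetics ν k₂ q₁) : LoopMatrices n ν k₁ k₂ r := P.loop (P.ctrl ε)

end Setup

/-! ### Functions of matrices -/

section MatrixFunctions

variable {ι : Type*} [Fintype ι] [DecidableEq ι]

/-- The entire function `cos` of a matrix. -/
def matCos (X : Matrix ι ι ℂ) : Matrix ι ι ℂ :=
  ∑' k : ℕ, ((-1 : ℂ) ^ k / ((2 * k).factorial : ℂ)) • X ^ (2 * k)

/-- The entire function `sinc z = sin z / z` (with `sinc 0 = 1`) of a matrix. -/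
def matSinc (X : Matrix ι ι ℂ) : Matrix ι ι ℂ :=
  ∑' k : ℕ, ((-1 : ℂ) ^ k / ((2 * k + 1).factorial : ℂ)) • X ^ (2 * k)

/-- The function `tanc z = tan z / z = sinc z / cos z` of a matrix. -/
def matTanc (X : Matrix ι ι ℂ) : Matrix ι ι ℂ := matSinc X * (matCos X)⁻¹

/-- The entire function `φ(u) = (exp u - 1) / u` (with `φ(0) = 1`) of a matrix. -/
def matPhi (X : Matrix ι ι ℂ) : Matrix ι ι ℂ :=
  ∑' k : ℕ, (1 / ((k + 1).factorial : ℂ)) • X ^ k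

end MatrixFunctions

/-- The Frobenius inner product of complex matrices. -/
def frobInner {ι κ : Type*} [Fintype ι] [Fintype κ] (X Y : Matrix ι κ ℂ) : ℂ :=
  (Xᴴ * Y).trace

/-- The Frobenius norm of a complex matrix. -/
def frobNorm {ι κ : Type*} [Fintype ι] [Fintype κ] (X : Matrix ι κ ℂ) : ℝ :=
  Real.sqrt (frobInner X X).re

/-! ### Spectral functions

In this section `F` stands for the value `F(iλ)` of the transfer matrix at a frequency `λ`. -/

section Spectral

variable {k₁ k₂ r : ℕ}

/-- `Φ = F F*` -/
def specΦ (F : Matrix (Fin r) (NoiseIdx k₁ k₂) ℂ) : Matrix (Fin r) (Fin r) ℂ := F * Fᴴ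

/-- `Ψ = F J F*` -/
def specΨ (F : Matrix (Fin r) (NoiseIdx k₁ k₂) ℂ) : Matrix (Fin r) (Fin r) ℂ :=
  F * noiseJC k₁ k₂ * Fᴴ

/-- `D_θ = cos(θ Ψ) - θ Φ sinc(θ Ψ)` -/
def specD (θ : ℝ) (F : Matrix (Fin r) (NoiseIdx k₁ k₂) ℂ) : Matrix (Fin r) (Fin r) ℂ :=
  matCos ((θ : ℂ) • specΨ F) - (θ : ℂ) • (specΦ F * matSinc ((θ : ℂ) • specΨ F))

/-- `φ(2iθΨ)` -/
def phiΨ (θ : ℝ) (F : Matrix (Fin r) (NoiseIdx k₁ k₂) ℂ) : Matrix (Fin r) (Fin r) ℂ :=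
  matPhi ((2 * Complex.I * (θ : ℂ)) • specΨ F)

/-- `Σ_θ = S F* φ(2iθΨ) F S` -/
def specSigma (θ : ℝ) (F : Matrix (Fin r) (NoiseIdx k₁ k₂) ℂ) :
    Matrix (NoiseIdx k₁ k₂) (NoiseIdx k₁ k₂) ℂ :=
  itoRoot k₁ k₂ * Fᴴ * phiΨ θ F * F * itoRoot k₁ k₂

/-- `Δ_θ = I - θ Σ_θ` -/
def specDelta (θ : ℝ) (F : Matrix (Fin r) (NoiseIdx k₁ k₂) ℂ) :
    Matrix (NoiseIdx k₁ k₂) (NoiseIdx k₁ k₂) ℂ :=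
  1 - (θ : ℂ) • specSigma θ F

/-- `S Δ_θ⁻¹ S` -/
def specSDS (θ : ℝ) (F : Matrix (Fin r) (NoiseIdx k₁ k₂) ℂ) :
    Matrix (NoiseIdx k₁ k₂) (NoiseIdx k₁ k₂) ℂ :=
  itoRoot k₁ k₂ * (specDelta θ F)⁻¹ * itoRoot k₁ k₂

/-- `ϖ_θ`, the bottom left block of `φ [[2iθΨ, 0], [F S Δ_θ⁻¹ S F*, 2iθΨ]]` -/
def specVarpi (θ : ℝ) (F : Matrix (Fin r) (NoiseIdx k₁ k₂) ℂ) : Matrix (Fin r) (Fin r) ℂ :=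
  (matPhi (Matrix.fromBlocks
    ((2 * Complex.I * (θ : ℂ)) • specΨ F) 0
    (F * specSDS θ F * Fᴴ) ((2 * Complex.I * (θ : ℂ)) • specΨ F))).toBlocks₂₁

/-- The weighting operator
`𝔐_{θ,F} : X ↦ φ(2iθΨ) X (S Δ_θ⁻¹ S) + ϖ_θ X (2iθJ)` at a fixed frequency. -/
def weighting (θ : ℝ) (F : Matrix (Fin r) (NoiseIdx k₁ k₂) ℂ) :
    Matrix (Fin r) (NoiseIdx k₁ k₂) ℂ →ₗ[ℂ] Matrix (Fin r) (NoiseIdx k₁ k₂) ℂ where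
  toFun X := phiΨ θ F * X * specSDS θ F
    + specVarpi θ F * X * ((2 * Complex.I * (θ : ℂ)) • noiseJC k₁ k₂)
  map_add' X Y := by
    simp only [Matrix.mul_add, Matrix.add_mul]
    abel
  map_smul' c X := by
    simp only [Matrix.mul_smul, Matrix.smul_mul, smul_add, RingHom.id_apply]
    rw [smul_comm]

end Spectral

/-! ### Cost functionals -/

section Costs

variable {n ν k₁ k₂ r : ℕ}

/-- The transfer matrix `F(s) = 𝒞 (s I - 𝒜)⁻¹ ℬ`. -/
def transfer (Γ : LoopMatrices n ν k₁ k₂ r) (s : ℂ) : Matrix (Fin r) (NoiseIdx k₁ k₂) ℂ :=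
  Γ.2.2.map Complex.ofReal * (s • (1 : Matrix (Fin n ⊕ Fin ν) (Fin n ⊕ Fin ν) ℂ)
    - Γ.1.map Complex.ofReal)⁻¹ * Γ.2.1.map Complex.ofReal

/-- The value `F(iλ)` of the transfer matrix at the frequency `λ`. -/
def freq (Γ : LoopMatrices n ν k₁ k₂ r) (l : ℝ) : Matrix (Fin r) (NoiseIdx k₁ k₂) ℂ :=
  transfer Γ (Complex.I * (l : ℂ))

/-- The logarithm of `det D_θ(λ)` (a positive real number under the spectral constraint). -/
def logDetD (θ : ℝ) (Γ : LoopMatrices n ν k₁ k₂ r) (l : ℝ) : ℝ :=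
  Real.log (specD θ (freq Γ l)).det.re

/-- The growth rate of the quadratic-exponential functional,
`Υ_θ = -(1/4π) ∫ log det D_θ(λ) dλ`. -/
def qefRate (θ : ℝ) (Γ : LoopMatrices n ν k₁ k₂ r) : ℝ :=
  -(1 / (4 * Real.pi)) * ∫ l : ℝ, logDetD θ Γ l

/-- The integrand `⟨F(iλ), 𝔐_λ(F(iλ))⟩` of the weighted quadratic cost. -/
def weightedDensity
    (𝔐 : ℝ → Matrix (Fin r) (NoiseIdx k₁ k₂) ℂ →ₗ[ℂ] Matrix (Fin r) (NoiseIdx k₁ k₂) ℂ)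
    (Γ : LoopMatrices n ν k₁ k₂ r) (l : ℝ) : ℂ :=
  frobInner (freq Γ l) (𝔐 l (freq Γ l))

/-- The weighted quadratic cost `V = (1/4π) ∫ ⟨F, 𝔐(F)⟩ dλ` with a given frequency-dependent
operator `𝔐` (the integral is real if `𝔐` is self-adjoint). -/
def weightedCost
    (𝔐 : ℝ → Matrix (Fin r) (NoiseIdx k₁ k₂) ℂ →ₗ[ℂ] Matrix (Fin r) (NoiseIdx k₁ k₂) ℂ)
    (Γ : LoopMatrices n ν k₁ k₂ r) : ℝ :=
  1 / (4 * Real.pi) * (∫ l : ℝ, weightedDensity 𝔐 Γ l).re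

/-! ### Admissible controllers -/

/-- Internal stability: all eigenvalues of `𝒜` lie in the open left half-plane. -/
def IsHurwitz (Γ : LoopMatrices n ν k₁ k₂ r) : Prop :=
  ∀ μ ∈ spectrum ℂ (Γ.1.map Complex.ofReal), μ.re < 0

/-- The two-point commutator kernel `Λ(τ)` of the criterion process. -/
def ccrKernel (Θ : Matrix (Fin n ⊕ Fin ν) (Fin n ⊕ Fin ν) ℝ) (Γ : LoopMatrices n ν k₁ k₂ r)
    (τ : ℝ) : Matrix (Fin r) (Fin r) ℝ :=
  Γ.2.2 * (if 0 ≤ τ then NormedSpace.exp (τ • Γ.1) * Θ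
    else Θ * NormedSpace.exp (-(τ • Γ.1ᵀ))) * Γ.2.2ᵀ

/-- Complete noncommutativity: for all sufficiently large `T`, the integral operator on
`L²([0, T], ℂ^r)` with the kernel `Λ(s - t)` has no nontrivial kernel. -/
def CompletelyNoncommutative (Θ : Matrix (Fin n ⊕ Fin ν) (Fin n ⊕ Fin ν) ℝ)
    (Γ : LoopMatrices n ν k₁ k₂ r) : Prop :=
  ∀ᶠ T : ℝ in atTop, ∀ f : ℝ → Fin r → ℂ,
    MemLp f 2 (volume.restrict (Set.Icc 0 T)) →
    (∀ᵐ s ∂(volume.restrict (Set.Icc 0 T)),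
      ∫ t in Set.Icc 0 T, (ccrKernel Θ Γ (s - t)).map Complex.ofReal *ᵥ f t = 0) →
    f =ᵐ[volume.restrict (Set.Icc 0 T)] 0

/-- The spectral constraint `θ sup_λ λ_max(Φ(λ) tanc(θΨ(λ))) < 1`. (The eigenvalues of the
product of positive semi-definite matrices `Φ`, `tanc(θΨ)` are real.) -/
def SpectralConstraint (θ : ℝ) (Γ : LoopMatrices n ν k₁ k₂ r) : Prop :=
  ∃ ρ : ℝ, ρ < 1 ∧ ∀ l μ : ℝ,
    (μ : ℂ) ∈ spectrum ℂ (specΦ (freq Γ l) * matTanc ((θ : ℂ) • specΨ (freq Γ l))) →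
      θ * μ ≤ ρ

/-- Admissible controllers for the risk-sensitive control problem with parameter `θ`. -/
structure Admissible {q₁ q₂ : ℕ} (P : Setup n ν k₁ k₂ q₁ q₂ r) (θ : ℝ)
    (ε : Energetics ν k₂ q₁) : Prop where
  hurwitz : IsHurwitz (P.closedLoop ε)
  noncommutative : CompletelyNoncommutative P.Θ (P.closedLoop ε)
  spectral : SpectralConstraint θ (P.closedLoop ε)

end Costs

/-! ### Frechet derivatives and stationarity -/

/-- The Frechet derivative of a scalar function of a real matrix, as a matrix `∂f` with
`δf = ⟨∂f, δX⟩` in the Frobenius inner product (whenever `f` is differentiable). -/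
def matGrad {ι κ : Type*} [Fintype ι] [Fintype κ] [DecidableEq ι] [DecidableEq κ]
    (f : Matrix ι κ ℝ → ℝ) (X : Matrix ι κ ℝ) : Matrix ι κ ℝ :=
  Matrix.of fun i j => fderiv ℝ f X (Matrix.single i j 1)

section Stationarity

variable {n ν k₁ k₂ q₁ q₂ r : ℕ}

/-- The triple of the partial Frechet derivatives of a cost with respect to `𝒜`, `ℬ`, `𝒞`
(the nontrivial blocks of `∂_Γ`). -/
def loopGrad (cost : LoopMatrices n ν k₁ k₂ r → ℝ) (Γ : LoopMatrices n ν k₁ k₂ r) :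
    LoopMatrices n ν k₁ k₂ r :=
  (matGrad (fun X => cost (X, Γ.2.1, Γ.2.2)) Γ.1,
    matGrad (fun X => cost (Γ.1, X, Γ.2.2)) Γ.2.1,
    matGrad (fun X => cost (Γ.1, Γ.2.1, X)) Γ.2.2)

/-- The quadruple of the partial Frechet derivatives of a cost with respect to the controller
matrices `a`, `b`, `c`, `e` as independent variables. -/
def ctrlGrad (P : Setup n ν k₁ k₂ q₁ q₂ r) (cost : LoopMatrices n ν k₁ k₂ r → ℝ)
    (γ : CtrlMatrices ν k₂ q₁ q₂) : CtrlMatrices ν k₂ q₁ q₂ :=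
  (matGrad (fun X => cost (P.loop (X, γ.2.1, γ.2.2.1, γ.2.2.2))) γ.1,
    matGrad (fun X => cost (P.loop (γ.1, X, γ.2.2.1, γ.2.2.2))) γ.2.1,
    matGrad (fun X => cost (P.loop (γ.1, γ.2.1, X, γ.2.2.2))) γ.2.2.1,
    matGrad (fun X => cost (P.loop (γ.1, γ.2.1, γ.2.2.1, X))) γ.2.2.2)

/-- symmetric part of a square matrix -/
def symPart {ι : Type*} (X : Matrix ι ι ℝ) : Matrix ι ι ℝ := (1 / 2 : ℝ) • (X + Xᵀ)

/-- antisymmetric part of a square matrix -/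
def antisymPart {ι : Type*} (X : Matrix ι ι ℝ) : Matrix ι ι ℝ := (1 / 2 : ℝ) • (X - Xᵀ)

/-- The first-order optimality conditions for a cost functional at the controller with the
energy and coupling matrices `ε = (R₂, M₂, L₂)`; here `g` is the quadruple
`(∂_a, ∂_b, ∂_c, ∂_e)` of partial Frechet derivatives of the cost. -/
def IsStationaryController (P : Setup n ν k₁ k₂ q₁ q₂ r) (cost : LoopMatrices n ν k₁ k₂ r → ℝ)
    (ε : Energetics ν k₂ q₁) : Prop :=
  let g := ctrlGrad P cost (P.ctrl ε)
  symPart (P.Θ₂ * g.1) = 0 ∧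
  (2 : ℝ) • (fieldJ k₂ * ε.2.1 * antisymPart (P.Θ₂ * g.1)) + g.2.1ᵀ * P.Θ₂
    - fieldJ k₂ * P.dᵀ * g.2.2.1 = 0 ∧
  (2 : ℝ) • (P.Jt₁ * ε.2.2 * antisymPart (P.Θ₂ * g.1)) + g.2.2.2ᵀ * P.Θ₂ = 0

end Stationarity

end CQRS

end

open CQRS

/-!
The Weinstein–Aronszajn identity, together with `φ (2H) = sinhc H * exp H` for `H = iθΨ`, gives
`det Δ_θ = det D_θ * exp (iθ tr Ψ)`. As `tr Ψ` is odd in the frequency, it integrates to zero, and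
so `Υ_θ = -(1/4π) ∫ ln det Δ_θ`. Jacobi's formula and the symmetry
`Tr (G * Dφ(X)[V]) = Tr (Dφ(X)[G] * V)` then yield `d (ln det Δ_θ) = -2θ Re ⟨𝔐(F), dF⟩`. On the
other hand, the derivative of `⟨F, 𝔐(F)⟩` for a fixed self-adjoint `𝔐` is `2 Re ⟨𝔐(F), dF⟩`, whence
`dΥ_θ = θ dV`. Differentiation under the integral is legitimate because near a Hurwitz system `F`
and `dF` are uniformly `O(1/(1 + |λ|))`, while both integrands are `O(‖F‖²)`.
-/

namespace CQRS

/-! ### Functions of diagonalizable matrices -/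

section Diagonalizable

open scoped ComplexOrder MatrixOrder

/-- The entire function `sin z / z`. -/
noncomputable def cSinc (z : ℂ) : ℂ := if z = 0 then 1 else Complex.sin z / z

theorem mul_cSinc (z : ℂ) : z * cSinc z = Complex.sin z := by
  unfold cSinc
  split_ifs with h
  · simp [h]
  · field_simp

theorem hasSum_cSinc (z : ℂ) :
    HasSum (fun k : ℕ => (-1) ^ k / ((2 * k + 1).factorial : ℂ) * z ^ (2 * k)) (cSinc z) := by
  unfold cSinc
  split_ifs with h
  · refine (hasSum_ite_eq (0 : ℕ) (1 : ℂ)).congr_fun fun k => ?_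
    rcases k with _ | k <;> simp [h]
  · refine ((Complex.hasSum_sin z).div_const z).congr_fun fun k => ?_
    rw [pow_succ]
    field_simp

theorem two_I_mul_mul_cSinc_mul_exp (z : ℂ) :
    2 * Complex.I * z * (cSinc z * Complex.exp (Complex.I * z))
      = Complex.exp (2 * Complex.I * z) - 1 := by
  have hexp : Complex.exp (-z * Complex.I) * Complex.exp (z * Complex.I) = 1 := by
    rw [neg_mul, ← Complex.exp_add, neg_add_cancel, Complex.exp_zero]
  have hsin : 2 * Complex.sin z * Complex.I
      = Complex.exp (z * Complex.I) - Complex.exp (-z * Complex.I) := by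
    rw [Complex.sin]
    linear_combination
      (Complex.exp (-z * Complex.I) - Complex.exp (z * Complex.I)) * Complex.I_sq
  have hsq : Complex.exp (2 * Complex.I * z) = Complex.exp (z * Complex.I) ^ 2 := by
    rw [← Complex.exp_nat_mul]
    push_cast
    ring_nf
  rw [hsq, mul_comm Complex.I z]
  linear_combination 2 * Complex.I * Complex.exp (z * Complex.I) * mul_cSinc z +
    Complex.exp (z * Complex.I) * hsin - hexp

theorem hasSum_cSinc_mul_exp (z : ℂ) :
    HasSum (fun k : ℕ => 1 / ((k + 1).factorial : ℂ) * (2 * Complex.I * z) ^ k)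
      (cSinc z * Complex.exp (Complex.I * z)) := by
  rcases eq_or_ne z 0 with rfl | hz
  · refine (hasSum_ite_eq (0 : ℕ) (cSinc 0 * Complex.exp (Complex.I * 0))).congr_fun fun k => ?_
    rcases k with _ | k <;> simp [cSinc]
  have hw : 2 * Complex.I * z ≠ 0 := by simp [hz]
  have hexp : HasSum (fun k : ℕ => (2 * Complex.I * z) ^ k / (k.factorial : ℂ))
      (Complex.exp (2 * Complex.I * z)) :=
    Complex.exp_eq_exp_ℂ ▸ NormedSpace.expSeries_div_hasSum_exp _
  rw [← hasSum_nat_add_iff' 1, Finset.sum_range_one, pow_zero, Nat.factorial_zero, Nat.cast_one,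
    div_one, ← two_I_mul_mul_cSinc_mul_exp] at hexp
  refine (mul_div_cancel_left₀ (cSinc z * _) hw ▸ hexp.div_const _).congr_fun fun k => ?_
  rw [pow_succ]
  field_simp

theorem one_add_I_mul_mul_cSinc_mul_exp (z : ℂ) :
    1 + Complex.I * z * (cSinc z * Complex.exp (Complex.I * z))
      = Complex.cos z * Complex.exp (Complex.I * z) := by
  have hexp : Complex.exp (Complex.I * z) * Complex.exp (-(Complex.I * z)) = 1 := by
    rw [← Complex.exp_add, add_neg_cancel, Complex.exp_zero]
  have hcis : Complex.exp (-(Complex.I * z)) = Complex.cos z - Complex.sin z * Complex.I := by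
    rw [mul_comm, ← neg_mul, Complex.cos_sub_sin_I]
  rw [hcis] at hexp
  linear_combination Complex.I * Complex.exp (Complex.I * z) * mul_cSinc z - hexp

theorem cSinc_mul_I_pos (x : ℝ) : 0 < cSinc (x * Complex.I) := by
  unfold cSinc
  split_ifs with h
  · exact one_pos
  have hx : x ≠ 0 := fun hx => h (by simp [hx])
  rw [Complex.sin_mul_I, mul_div_mul_right _ _ Complex.I_ne_zero, ← Complex.ofReal_sinh,
    ← Complex.ofReal_div, Complex.zero_lt_real]
  rcases hx.lt_or_gt with h | h
  · exact div_pos_of_neg_of_neg (Real.sinh_neg_iff.2 h) h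
  · exact div_pos (Real.sinh_pos_iff.2 h) h

theorem cos_mul_I_pos (x : ℝ) : 0 < Complex.cos (x * Complex.I) := by
  rw [Complex.cos_mul_I, ← Complex.ofReal_cosh, Complex.zero_lt_real]
  exact Real.cosh_pos x

variable {ι : Type*} [Fintype ι] [DecidableEq ι]

/-- The functional calculus `f ↦ U diag(f) U*` of the normal matrices diagonalized by `U`. -/
noncomputable def diagConj (U : Matrix.unitaryGroup ι ℂ) : (ι → ℂ) →ₐ[ℂ] Matrix ι ι ℂ :=
  (Unitary.conjStarAlgAut ℂ (Matrix ι ι ℂ) U).toAlgEquiv.toAlgHom.comp (Matrix.diagonalAlgHom ℂ)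

variable (U : Matrix.unitaryGroup ι ℂ)

theorem diagConj_apply (f : ι → ℂ) :
    diagConj U f = U * Matrix.diagonal f * (U : Matrix ι ι ℂ)ᴴ := rfl

theorem det_diagConj (f : ι → ℂ) : (diagConj U f).det = ∏ i, f i := by
  rw [diagConj_apply, Matrix.det_mul_comm, ← Matrix.mul_assoc, ← Matrix.star_eq_conjTranspose,
    Unitary.coe_star_mul_self, Matrix.one_mul, Matrix.det_diagonal]

theorem trace_diagConj (f : ι → ℂ) : (diagConj U f).trace = ∑ i, f i := by
  rw [diagConj_apply, Matrix.trace_mul_comm, ← Matrix.mul_assoc, ← Matrix.star_eq_conjTranspose,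
    Unitary.coe_star_mul_self, Matrix.one_mul, Matrix.trace_diagonal]

theorem posSemidef_diagConj {f : ι → ℂ} (hf : 0 ≤ f) : (diagConj U f).PosSemidef :=
  (Matrix.PosSemidef.diagonal hf).mul_mul_conjTranspose_same _

theorem hasSum_smul_diagConj_pow {f g : ι → ℂ} {c : ℕ → ℂ} {n : ℕ → ℕ}
    (h : ∀ i, HasSum (fun k => c k * f i ^ n k) (g i)) :
    HasSum (fun k => c k • diagConj U f ^ n k) (diagConj U g) := by
  refine ((Pi.hasSum.2 h).map (diagConj U) (LinearMap.continuous_of_finiteDimensional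
    (diagConj U).toLinearMap)).congr_fun fun k => ?_
  rw [← map_pow, ← map_smul]
  rfl

theorem matCos_diagConj (f : ι → ℂ) :
    matCos (diagConj U f) = diagConj U fun i => Complex.cos (f i) := by
  refine (hasSum_smul_diagConj_pow U fun i => ?_).tsum_eq
  exact (Complex.hasSum_cos (f i)).congr_fun fun k => div_mul_eq_mul_div ..

theorem matSinc_diagConj (f : ι → ℂ) :
    matSinc (diagConj U f) = diagConj U fun i => cSinc (f i) :=
  (hasSum_smul_diagConj_pow U fun i => hasSum_cSinc (f i)).tsum_eq

theorem matPhi_two_I_smul_diagConj (f : ι → ℂ) :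
    matPhi ((2 * Complex.I) • diagConj U f)
      = diagConj U fun i => cSinc (f i) * Complex.exp (Complex.I * f i) := by
  rw [← map_smul]
  refine (hasSum_smul_diagConj_pow U (n := id) fun i => ?_).tsum_eq
  exact hasSum_cSinc_mul_exp (f i)

theorem matTanc_diagConj {f : ι → ℂ} (hf : ∀ i, Complex.cos (f i) ≠ 0) :
    matTanc (diagConj U f) = diagConj U fun i => cSinc (f i) / Complex.cos (f i) := by
  rw [matTanc, matCos_diagConj, matSinc_diagConj]
  have hinv : (diagConj U fun i => Complex.cos (f i)) * diagConj U (fun i => (Complex.cos (f i))⁻¹)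
      = 1 := by
    rw [← map_mul, ← map_one (diagConj U)]
    exact congrArg _ (funext fun i => mul_inv_cancel₀ (hf i))
  rw [Matrix.inv_eq_right_inv hinv, ← map_mul]
  rfl

theorem exists_diagConj_of_isHermitian {A : Matrix ι ι ℂ} (hA : A.IsHermitian) :
    ∃ U, A = diagConj U fun i => (hA.eigenvalues i : ℂ) :=
  ⟨hA.eigenvectorUnitary, hA.spectral_theorem⟩

theorem exists_diagConj_of_antihermitian {X : Matrix ι ι ℂ} (hX : Xᴴ = -X) :
    ∃ U, ∃ x : ι → ℝ, X = diagConj U fun i => x i * Complex.I := by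
  have hA : (-Complex.I • X).IsHermitian := by
    rw [Matrix.IsHermitian, Matrix.conjTranspose_smul, hX]
    simp
  obtain ⟨U, hU⟩ := exists_diagConj_of_isHermitian hA
  refine ⟨U, hA.eigenvalues, ?_⟩
  calc X = Complex.I • (-Complex.I • X) := by rw [smul_smul]; simp
    _ = diagConj U (Complex.I • fun i => (hA.eigenvalues i : ℂ)) := by
      rw [map_smul]
      exact congrArg _ hU
    _ = _ := congrArg _ (funext fun i => mul_comm ..)

theorem det_one_sub_smul_pos {A : Matrix ι ι ℂ} (hA : A.IsHermitian) {θ : ℝ}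
    (h : ∀ x : ℝ, (x : ℂ) ∈ spectrum ℂ A → θ * x < 1) : 0 < (1 - (θ : ℂ) • A).det := by
  obtain ⟨U, hU⟩ := exists_diagConj_of_isHermitian hA
  have hdiag : 1 - (θ : ℂ) • A
      = diagConj U (1 - (θ : ℂ) • fun i => (hA.eigenvalues i : ℂ)) := by
    rw [map_sub, map_smul, map_one, ← hU]
  rw [hdiag, det_diagConj]
  refine Finset.prod_pos fun i _ => ?_
  have hi : θ * hA.eigenvalues i < 1 := h _ (by
    rw [hA.spectrum_eq_image_range]
    exact ⟨_, ⟨i, rfl⟩, rfl⟩)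
  change 0 < 1 - (θ : ℂ) * (hA.eigenvalues i : ℂ)
  exact_mod_cast sub_pos.2 hi

theorem det_one_sub_smul_mul_pos {Φ T : Matrix ι ι ℂ} (hΦ : Φ.IsHermitian) (hT : T.PosSemidef)
    {θ : ℝ} (h : ∀ x : ℝ, (x : ℂ) ∈ spectrum ℂ (Φ * T) → θ * x < 1) :
    0 < (1 - (θ : ℂ) • (Φ * T)).det := by
  obtain ⟨R, rfl⟩ := CStarAlgebra.nonneg_iff_eq_star_mul_self.1 hT.nonneg
  simp only [Matrix.star_eq_conjTranspose] at h ⊢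
  rw [← Matrix.mul_assoc, ← Matrix.smul_mul, Matrix.det_one_sub_mul_comm, Matrix.mul_smul,
    ← Matrix.mul_assoc]
  refine det_one_sub_smul_pos (Matrix.isHermitian_mul_mul_conjTranspose R hΦ) fun x hx => ?_
  rcases eq_or_ne x 0 with rfl | hx0
  · simp
  refine h x (Set.mem_of_mem_sdiff (t := {0}) ?_)
  rw [← Matrix.mul_assoc, spectrum.nonzero_mul_comm, ← Matrix.mul_assoc]
  exact ⟨hx, by simpa using hx0⟩

theorem det_matCos_pos {X : Matrix ι ι ℂ} (hX : Xᴴ = -X) : 0 < (matCos X).det := by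
  obtain ⟨U, x, rfl⟩ := exists_diagConj_of_antihermitian hX
  rw [matCos_diagConj, det_diagConj]
  exact Finset.prod_pos fun i _ => cos_mul_I_pos (x i)

theorem posSemidef_matTanc {X : Matrix ι ι ℂ} (hX : Xᴴ = -X) : (matTanc X).PosSemidef := by
  obtain ⟨U, x, rfl⟩ := exists_diagConj_of_antihermitian hX
  rw [matTanc_diagConj U fun i => (cos_mul_I_pos (x i)).ne']
  exact posSemidef_diagConj U fun i => (div_pos (cSinc_mul_I_pos (x i)) (cos_mul_I_pos (x i))).le

theorem det_matCos_sub_pos {X Φ : Matrix ι ι ℂ} (hX : Xᴴ = -X) (hΦ : Φ.IsHermitian) {θ : ℝ}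
    (h : ∀ x : ℝ, (x : ℂ) ∈ spectrum ℂ (Φ * matTanc X) → θ * x < 1) :
    0 < (matCos X - (θ : ℂ) • (Φ * matSinc X)).det := by
  have hcos := det_matCos_pos hX
  have hsplit : matCos X - (θ : ℂ) • (Φ * matSinc X)
      = (1 - (θ : ℂ) • (Φ * matTanc X)) * matCos X := by
    rw [matTanc, Matrix.sub_mul, Matrix.one_mul, Matrix.smul_mul, Matrix.mul_assoc,
      Matrix.nonsing_inv_mul_cancel_right _ _ hcos.ne'.isUnit]
  rw [hsplit, Matrix.det_mul]
  exact mul_pos (det_one_sub_smul_mul_pos hΦ (posSemidef_matTanc hX) h) hcos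

-- For `H = i X` this is `1 - (Φ - H) φ(2H) = (cosh H - Φ sinhc H) exp H`.
theorem det_one_sub_mul_matPhi {X : Matrix ι ι ℂ} (hX : Xᴴ = -X) (Φ : Matrix ι ι ℂ) :
    (1 - (Φ - Complex.I • X) * matPhi ((2 * Complex.I) • X)).det
      = (matCos X - Φ * matSinc X).det * Complex.exp (Complex.I * X.trace) := by
  obtain ⟨U, x, rfl⟩ := exists_diagConj_of_antihermitian hX
  set f : ι → ℂ := fun i => x i * Complex.I
  have hφ : matPhi ((2 * Complex.I) • diagConj U f)
      = matSinc (diagConj U f) * diagConj U fun i => Complex.exp (Complex.I * f i) := by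
    rw [matPhi_two_I_smul_diagConj, matSinc_diagConj, ← map_mul]
    rfl
  have hcos : 1 + Complex.I • diagConj U f * matPhi ((2 * Complex.I) • diagConj U f)
      = matCos (diagConj U f) * diagConj U fun i => Complex.exp (Complex.I * f i) := by
    rw [matPhi_two_I_smul_diagConj, matCos_diagConj, ← map_smul, ← map_mul, ← map_mul,
      ← map_one (diagConj U), ← map_add]
    exact congrArg _ (funext fun i => one_add_I_mul_mul_cSinc_mul_exp (f i))
  have hdet : (diagConj U fun i => Complex.exp (Complex.I * f i)).det
      = Complex.exp (Complex.I * (diagConj U f).trace) := by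
    rw [det_diagConj, trace_diagConj, Finset.mul_sum, Complex.exp_sum]
  rw [← hdet, ← Matrix.det_mul, Matrix.sub_mul (matCos _), ← hcos, Matrix.mul_assoc, ← hφ,
    Matrix.sub_mul]
  congr 1
  abel

end Diagonalizable

section FrobeniusTopology

open scoped Matrix.Norms.Frobenius
-- The Frobenius norm induces the product topology, but the two are equal only up to unfolding.
attribute [-instance] instTopologicalSpaceMatrix Matrix.instUniformSpace

/-! ### Matrix calculus -/

section Calculus

variable {E ι κ μ : Type*} [NormedAddCommGroup E] [NormedSpace ℝ E]
  [Fintype ι] [Fintype κ] [Fintype μ]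

section Entries

variable {α : Type*} [NormedAddCommGroup α] [NormedSpace ℝ α] [FiniteDimensional ℝ α]

theorem differentiable_matrix {f : E → Matrix ι κ α} :
    Differentiable ℝ f ↔ ∀ i j, Differentiable ℝ fun x => f x i j := by
  rw [← (Matrix.ofLinearEquiv ℝ (m := ι) (n := κ)
    (α := α)).symm.toContinuousLinearEquiv.comp_differentiable_iff, differentiable_pi]
  exact forall_congr' fun i => differentiable_pi

theorem differentiable_fromBlocks {ξ : Type*} [Fintype ξ] {X : E → Matrix ι κ α}
    {Y : E → Matrix ι μ α} {Z : E → Matrix ξ κ α} {W : E → Matrix ξ μ α} (hX : Differentiable ℝ X)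
    (hY : Differentiable ℝ Y) (hZ : Differentiable ℝ Z) (hW : Differentiable ℝ W) :
    Differentiable ℝ fun t => Matrix.fromBlocks (X t) (Y t) (Z t) (W t) := by
  refine differentiable_matrix.2 ?_
  rintro (i | i) (j | j)
  exacts [differentiable_matrix.1 hX i j, differentiable_matrix.1 hY i j,
    differentiable_matrix.1 hZ i j, differentiable_matrix.1 hW i j]

theorem differentiable_fromCols {X : E → Matrix ι κ α} {Y : E → Matrix ι μ α}
    (hX : Differentiable ℝ X) (hY : Differentiable ℝ Y) :
    Differentiable ℝ fun t => Matrix.fromCols (X t) (Y t) := by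
  refine differentiable_matrix.2 ?_
  rintro i (j | j)
  exacts [differentiable_matrix.1 hX i j, differentiable_matrix.1 hY i j]

end Entries

variable {𝕜 : Type*} [RCLike 𝕜]

/-- Matrix multiplication as a continuous bilinear map over the reals. -/
noncomputable def matrixMulL (ι κ μ 𝕜 : Type*) [Fintype ι] [Fintype κ] [Fintype μ] [RCLike 𝕜] :
    Matrix ι κ 𝕜 →L[ℝ] Matrix κ μ 𝕜 →L[ℝ] Matrix ι μ 𝕜 :=
  (mulLinearMap ℝ).toContinuousBilinearMap

theorem hasFDerivAt_matrix_mul {f : E → Matrix ι κ 𝕜} {g : E → Matrix κ μ 𝕜} {x : E}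
    (hf : DifferentiableAt ℝ f x) (hg : DifferentiableAt ℝ g x) :
    HasFDerivAt (fun y => f y * g y) ((matrixMulL ι κ μ 𝕜 (f x)).comp (fderiv ℝ g x) +
      ((matrixMulL ι κ μ 𝕜).flip (g x)).comp (fderiv ℝ f x)) x :=
  (matrixMulL ι κ μ 𝕜).hasFDerivAt_of_bilinear hf.hasFDerivAt hg.hasFDerivAt

theorem fderiv_matrix_mul_apply {f : E → Matrix ι κ 𝕜} {g : E → Matrix κ μ 𝕜} {x : E}
    (hf : DifferentiableAt ℝ f x) (hg : DifferentiableAt ℝ g x) (v : E) :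
    fderiv ℝ (fun y => f y * g y) x v = f x * fderiv ℝ g x v + fderiv ℝ f x v * g x := by
  rw [(hasFDerivAt_matrix_mul hf hg).fderiv]
  rfl

theorem differentiable_matrix_mul {f : E → Matrix ι κ 𝕜} {g : E → Matrix κ μ 𝕜}
    (hf : Differentiable ℝ f) (hg : Differentiable ℝ g) : Differentiable ℝ fun x => f x * g x :=
  fun x => (hasFDerivAt_matrix_mul (hf x) (hg x)).differentiableAt

/-- The conjugate transposition as a continuous real linear map. -/
noncomputable def conjTransposeL (ι κ 𝕜 : Type*) [Fintype ι] [Fintype κ] [RCLike 𝕜] :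
    Matrix ι κ 𝕜 →L[ℝ] Matrix κ ι 𝕜 :=
  LinearMap.toContinuousLinearMap (IsLinearMap.mk' Matrix.conjTranspose
    ⟨Matrix.conjTranspose_add, fun c X => by simp [Matrix.conjTranspose_smul]⟩)

theorem hasFDerivAt_conjTranspose {f : E → Matrix ι κ 𝕜} {x : E} (hf : DifferentiableAt ℝ f x) :
    HasFDerivAt (fun y => (f y)ᴴ) ((conjTransposeL ι κ 𝕜).comp (fderiv ℝ f x)) x :=
  (conjTransposeL ι κ 𝕜).hasFDerivAt.comp x hf.hasFDerivAt

theorem fderiv_conjTranspose_apply {f : E → Matrix ι κ 𝕜} {x : E} (hf : DifferentiableAt ℝ f x)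
    (v : E) : fderiv ℝ (fun y => (f y)ᴴ) x v = (fderiv ℝ f x v)ᴴ := by
  rw [(hasFDerivAt_conjTranspose hf).fderiv]
  rfl

theorem differentiable_conjTranspose {f : E → Matrix ι κ 𝕜} (hf : Differentiable ℝ f) :
    Differentiable ℝ fun x => (f x)ᴴ :=
  fun x => (hasFDerivAt_conjTranspose (hf x)).differentiableAt

end Calculus

/-! ### The function `φ` -/

section Phi

theorem fromBlocks_upper_pow {R ι κ : Type*} [Semiring R] [Fintype ι] [DecidableEq ι] [Fintype κ]
    [DecidableEq κ] (X : Matrix ι ι R) (V : Matrix ι κ R) (Y : Matrix κ κ R) (k : ℕ) :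
    (Matrix.fromBlocks X V 0 Y) ^ k = Matrix.fromBlocks (X ^ k)
      (∑ i ∈ Finset.range k, X ^ i * V * Y ^ (k - 1 - i)) 0 (Y ^ k) := by
  induction k with
  | zero => simp
  | succ k ih =>
    rw [pow_succ', ih, Matrix.fromBlocks_multiply, Finset.sum_range_succ']
    congr 1
    · simp [pow_succ']
    · simp [Matrix.mul_sum, pow_succ', Matrix.mul_assoc, Nat.sub_sub, Nat.add_comm 1]
    · simp
    · simp [pow_succ']

theorem sum_pow_mul_sub_mul_pow {R : Type*} [Ring R] (x y : R) (k : ℕ) :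
    ∑ i ∈ Finset.range k, x ^ i * (y - x) * y ^ (k - 1 - i) = y ^ k - x ^ k := by
  induction k with
  | zero => simp
  | succ k ih =>
    have hstep : ∀ i ∈ Finset.range k,
        x ^ i * (y - x) * y ^ (k - i) = x ^ i * (y - x) * y ^ (k - 1 - i) * y := fun i hi => by
      rw [mul_assoc _ _ y, ← pow_succ]
      congr 2
      have := Finset.mem_range.1 hi
      omega
    rw [Finset.sum_range_succ, Nat.add_sub_cancel, Finset.sum_congr rfl hstep, ← Finset.sum_mul, ih,
      Nat.sub_self]
    noncomm_ring

variable {ι κ : Type*} [Fintype ι] [DecidableEq ι] [Fintype κ] [DecidableEq κ]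

theorem hasSum_smul_toBlocks₁₂ {c : ℕ → ℂ} {f : ℕ → Matrix (ι ⊕ κ) (ι ⊕ κ) ℂ}
    {M : Matrix (ι ⊕ κ) (ι ⊕ κ) ℂ} (h : HasSum (fun k => c k • f k) M) :
    HasSum (fun k => c k • (f k).toBlocks₁₂) M.toBlocks₁₂ :=
  Pi.hasSum.2 fun i => Pi.hasSum.2 fun j => Pi.hasSum.1 (Pi.hasSum.1 h (Sum.inl i)) (Sum.inr j)

theorem hasSum_exp_fromBlocks (X : Matrix ι ι ℂ) :
    HasSum (fun k : ℕ => (1 / ((k + 1).factorial : ℂ)) • X ^ k)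
      (NormedSpace.exp (Matrix.fromBlocks X 1 0 0 : Matrix (ι ⊕ ι) (ι ⊕ ι) ℂ)).toBlocks₁₂ := by
  have hpow (k : ℕ) : ((Matrix.fromBlocks X 1 0 0 : Matrix (ι ⊕ ι) (ι ⊕ ι) ℂ) ^
      (k + 1)).toBlocks₁₂ = X ^ k := by
    rw [fromBlocks_upper_pow, Matrix.toBlocks_fromBlocks₁₂, Nat.add_sub_cancel,
      Finset.sum_range_succ, Finset.sum_eq_zero, zero_add, Nat.sub_self, pow_zero,
      Matrix.mul_one, Matrix.mul_one]
    intro i hi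
    rw [zero_pow (Nat.sub_ne_zero_of_lt (Finset.mem_range.1 hi)), Matrix.mul_zero]
  have h := hasSum_smul_toBlocks₁₂ (NormedSpace.exp_series_hasSum_exp' (𝕂 := ℂ)
    (Matrix.fromBlocks X 1 0 0 : Matrix (ι ⊕ ι) (ι ⊕ ι) ℂ))
  have hone : (1 : Matrix (ι ⊕ ι) (ι ⊕ ι) ℂ).toBlocks₁₂ = 0 := by
    rw [← Matrix.fromBlocks_one, Matrix.toBlocks_fromBlocks₁₂]
  rw [← hasSum_nat_add_iff' 1] at h
  simpa [hone, hpow] using h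

-- `φ(X)` is a block of `exp [[X, 1], [0, 0]]`, which reduces its analytic properties to `exp`.
theorem matPhi_eq_exp (X : Matrix ι ι ℂ) :
    matPhi X =
      (NormedSpace.exp (Matrix.fromBlocks X 1 0 0 : Matrix (ι ⊕ ι) (ι ⊕ ι) ℂ)).toBlocks₁₂ :=
  (hasSum_exp_fromBlocks X).tsum_eq

theorem hasSum_matPhi (X : Matrix ι ι ℂ) :
    HasSum (fun k : ℕ => (1 / ((k + 1).factorial : ℂ)) • X ^ k) (matPhi X) :=
  matPhi_eq_exp X ▸ hasSum_exp_fromBlocks X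

theorem differentiable_matPhi : Differentiable ℝ (matPhi : Matrix ι ι ℂ → Matrix ι ι ℂ) := by
  have hblocks : Differentiable ℝ fun X : Matrix ι ι ℂ =>
      (Matrix.fromBlocks X 1 0 0 : Matrix (ι ⊕ ι) (ι ⊕ ι) ℂ) :=
    differentiable_fromBlocks differentiable_id (differentiable_const _) (differentiable_const _)
      (differentiable_const _)
  have hexp : Differentiable ℝ (NormedSpace.exp :
      Matrix (ι ⊕ ι) (ι ⊕ ι) ℂ → Matrix (ι ⊕ ι) (ι ⊕ ι) ℂ) :=
    fun X => (NormedSpace.exp_analytic (𝕂 := ℝ) X).differentiableAt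
  rw [funext matPhi_eq_exp]
  exact differentiable_matrix.2 fun i j =>
    differentiable_matrix.1 (hexp.comp hblocks) (Sum.inl i) (Sum.inr j)

theorem matPhi_conjTranspose (X : Matrix ι ι ℂ) : (matPhi X)ᴴ = matPhi Xᴴ := by
  refine ((hasSum_matPhi X).mapL (conjTransposeL ι ι ℂ)).unique ?_
  convert hasSum_matPhi Xᴴ using 2 with k
  change ((1 / ((k + 1).factorial : ℂ)) • X ^ k)ᴴ = _
  simp [Matrix.conjTranspose_smul, Matrix.conjTranspose_pow]

theorem matPhi_reindex (e : ι ≃ κ) (X : Matrix ι ι ℂ) :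
    Matrix.reindex e e (matPhi X) = matPhi (Matrix.reindex e e X) := by
  refine ((hasSum_matPhi X).map (Matrix.reindexAlgEquiv ℂ ℂ e).toLinearMap
    (LinearMap.continuous_of_finiteDimensional _)).unique ?_
  refine (hasSum_matPhi (Matrix.reindexAlgEquiv ℂ ℂ e X)).congr_fun fun k => ?_
  simp only [Function.comp_apply, map_smul, AlgEquiv.toLinearMap_apply, map_pow]

theorem hasSum_matPhi_upper (X : Matrix ι ι ℂ) (V : Matrix ι κ ℂ) (Y : Matrix κ κ ℂ) :
    HasSum (fun k : ℕ => (1 / ((k + 1).factorial : ℂ)) •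
        ∑ i ∈ Finset.range k, X ^ i * V * Y ^ (k - 1 - i))
      (matPhi (Matrix.fromBlocks X V 0 Y)).toBlocks₁₂ := by
  simpa only [fromBlocks_upper_pow, Matrix.toBlocks_fromBlocks₁₂] using
    hasSum_smul_toBlocks₁₂ (hasSum_matPhi (Matrix.fromBlocks X V 0 Y))

theorem smul_toBlocks₁₂_matPhi (X V : Matrix ι ι ℂ) (t : ℝ) :
    t • (matPhi (Matrix.fromBlocks X V 0 (X + t • V))).toBlocks₁₂
      = matPhi (X + t • V) - matPhi X := by
  refine ((hasSum_matPhi_upper X V (X + t • V)).const_smul t).unique ?_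
  refine ((hasSum_matPhi (X + t • V)).sub (hasSum_matPhi X)).congr_fun fun k => ?_
  rw [← smul_sub, ← sum_pow_mul_sub_mul_pow, add_sub_cancel_left, smul_comm, Finset.smul_sum]
  simp only [Matrix.mul_smul, Matrix.smul_mul]

theorem fderiv_matPhi_apply (X V : Matrix ι ι ℂ) :
    fderiv ℝ matPhi X V = (matPhi (Matrix.fromBlocks X V 0 X)).toBlocks₁₂ := by
  have hslope : Tendsto (fun t : ℝ => t⁻¹ • (matPhi (X + t • V) - matPhi X)) (𝓝[≠] 0)
      (𝓝 (fderiv ℝ matPhi X V)) := by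
    simpa using ((differentiable_matPhi X).hasFDerivAt.hasLineDerivAt V).tendsto_slope_zero
  have hblock : Continuous fun t : ℝ =>
      (matPhi (Matrix.fromBlocks X V 0 (X + t • V))).toBlocks₁₂ := by
    have h : Continuous fun t : ℝ => Matrix.fromBlocks X V 0 (X + t • V) :=
      Continuous.matrix_fromBlocks continuous_const continuous_const continuous_const (by fun_prop)
    exact (differentiable_matPhi.continuous.comp h).matrix_submatrix Sum.inl Sum.inr
  refine tendsto_nhds_unique (hslope.congr' ?_)
    (by simpa using (hblock.tendsto 0).mono_left nhdsWithin_le_nhds)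
  filter_upwards [self_mem_nhdsWithin] with t ht
  rw [← smul_toBlocks₁₂_matPhi, inv_smul_smul₀ ht]

theorem toBlocks₂₁_matPhi_lower (X G : Matrix ι ι ℂ) :
    (matPhi (Matrix.fromBlocks X 0 G X)).toBlocks₂₁ = fderiv ℝ matPhi X G := by
  have hswap : Matrix.reindex (Equiv.sumComm ι ι) (Equiv.sumComm ι ι)
      (Matrix.fromBlocks X G 0 X) = Matrix.fromBlocks X 0 G X :=
    Matrix.fromBlocks_submatrix_sum_swap_sum_swap ..
  rw [fderiv_matPhi_apply, ← hswap, ← matPhi_reindex]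
  rfl

theorem fderiv_matPhi_conjTranspose (X V : Matrix ι ι ℂ) :
    (fderiv ℝ matPhi X V)ᴴ = fderiv ℝ matPhi Xᴴ Vᴴ := by
  rw [← toBlocks₂₁_matPhi_lower Xᴴ, fderiv_matPhi_apply]
  have h := matPhi_conjTranspose (Matrix.fromBlocks X V 0 X)
  rw [Matrix.fromBlocks_conjTranspose, Matrix.conjTranspose_zero] at h
  rw [← h]
  rfl

theorem hasSum_fderiv_matPhi (X V : Matrix ι ι ℂ) :
    HasSum (fun k : ℕ => (1 / ((k + 1).factorial : ℂ)) •
        ∑ i ∈ Finset.range k, X ^ i * V * X ^ (k - 1 - i)) (fderiv ℝ matPhi X V) :=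
  fderiv_matPhi_apply X V ▸ hasSum_matPhi_upper X V X

theorem trace_mul_fderiv_matPhi (X G V : Matrix ι ι ℂ) :
    (G * fderiv ℝ matPhi X V).trace = (fderiv ℝ matPhi X G * V).trace := by
  have htrace : Continuous (Matrix.traceLinearMap ι ℂ ℂ) :=
    LinearMap.continuous_of_finiteDimensional _
  have hleft := ((hasSum_fderiv_matPhi X V).mul_left G).map (Matrix.traceLinearMap ι ℂ ℂ) htrace
  have hright := ((hasSum_fderiv_matPhi X G).mul_right V).map (Matrix.traceLinearMap ι ℂ ℂ) htrace
  refine hleft.unique (hright.congr_fun fun k => ?_)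
  simp only [Function.comp_apply, Matrix.mul_smul, Matrix.smul_mul, map_smul, Finset.mul_sum,
    Finset.sum_mul, map_sum, Matrix.traceLinearMap_apply]
  rw [← Finset.sum_range_reflect]
  refine congrArg _ (Finset.sum_congr rfl fun i hi => ?_)
  rw [Nat.sub_sub_self (Nat.le_sub_one_of_lt (Finset.mem_range.1 hi)), ← Matrix.mul_assoc,
    Matrix.trace_mul_comm]
  simp only [Matrix.mul_assoc]

end Phi

/-! ### Algebra of the spectral functions -/

section SpectralAlgebra

variable {k₁ k₂ r : ℕ}

theorem fieldJ_transpose (k : ℕ) : (fieldJ k)ᵀ = -fieldJ k := by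
  have h : (!![0, 1; -1, 0] : Matrix (Fin 2) (Fin 2) ℝ)ᵀ = (-1 : ℝ) • !![0, 1; -1, 0] := by
    ext a b
    fin_cases a <;> fin_cases b <;> simp
  rw [fieldJ, ← Matrix.kroneckerMap_transpose, Matrix.transpose_one, h, Matrix.kronecker_smul,
    neg_one_smul]

theorem fieldJ_mul_self (k : ℕ) : fieldJ k * fieldJ k = -1 := by
  have h : (!![0, 1; -1, 0] * !![0, 1; -1, 0] : Matrix (Fin 2) (Fin 2) ℝ) = (-1 : ℝ) • 1 := by
    ext a b
    fin_cases a <;> fin_cases b <;> simp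
  rw [fieldJ, ← Matrix.mul_kronecker_mul, one_mul, h, Matrix.kronecker_smul,
    Matrix.one_kronecker_one, neg_one_smul]

theorem noiseJC_transpose (k₁ k₂ : ℕ) : (noiseJC k₁ k₂)ᵀ = -noiseJC k₁ k₂ := by
  have h : (noiseJ k₁ k₂)ᵀ = -noiseJ k₁ k₂ := by
    simp [noiseJ, Matrix.fromBlocks_transpose, fieldJ_transpose, Matrix.fromBlocks_neg]
  rw [noiseJC, ← Matrix.transpose_map, h]
  exact Matrix.map_neg _ Complex.ofReal_neg _

theorem noiseJC_conjTranspose (k₁ k₂ : ℕ) : (noiseJC k₁ k₂)ᴴ = -noiseJC k₁ k₂ := by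
  rw [← noiseJC_transpose]
  ext i j
  exact Complex.conj_ofReal _

theorem noiseJC_mul_self (k₁ k₂ : ℕ) : noiseJC k₁ k₂ * noiseJC k₁ k₂ = -1 := by
  have h : noiseJ k₁ k₂ * noiseJ k₁ k₂ = -1 := by
    rw [noiseJ, Matrix.fromBlocks_multiply, fieldJ_mul_self, fieldJ_mul_self,
      ← Matrix.fromBlocks_one, Matrix.fromBlocks_neg]
    simp
  have hmap := congrArg Complex.ofRealHom.mapMatrix h
  rwa [map_mul, map_neg, map_one] at hmap

theorem itoMatrix_transpose (k₁ k₂ : ℕ) :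
    (itoMatrix k₁ k₂)ᵀ = 1 - Complex.I • noiseJC k₁ k₂ := by
  rw [itoMatrix, Matrix.transpose_add, Matrix.transpose_one, Matrix.transpose_smul,
    noiseJC_transpose, smul_neg, sub_eq_add_neg]

theorem itoRoot_conjTranspose (k₁ k₂ : ℕ) : (itoRoot k₁ k₂)ᴴ = itoRoot k₁ k₂ := by
  rw [itoRoot, itoMatrix_transpose, Matrix.conjTranspose_smul, Matrix.conjTranspose_sub,
    Matrix.conjTranspose_smul, noiseJC_conjTranspose, Matrix.conjTranspose_one]
  simp

theorem itoRoot_mul_self (k₁ k₂ : ℕ) :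
    itoRoot k₁ k₂ * itoRoot k₁ k₂ = 1 - Complex.I • noiseJC k₁ k₂ := by
  have hscalar : ((1 / Real.sqrt 2 : ℝ) : ℂ) * ((1 / Real.sqrt 2 : ℝ) : ℂ) = 1 / 2 := by
    rw [← Complex.ofReal_mul, div_mul_div_comm, one_mul, Real.mul_self_sqrt (by norm_num)]
    push_cast
    rfl
  have hsq : (1 - Complex.I • noiseJC k₁ k₂) * (1 - Complex.I • noiseJC k₁ k₂)
      = (2 : ℂ) • (1 - Complex.I • noiseJC k₁ k₂) := by
    rw [mul_sub, mul_one, sub_mul, one_mul, Matrix.smul_mul, Matrix.mul_smul, noiseJC_mul_self,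
      smul_smul, Complex.I_mul_I, neg_smul, one_smul, neg_neg, two_smul]
    abel
  rw [itoRoot, itoMatrix_transpose, Matrix.smul_mul, Matrix.mul_smul, smul_smul, hscalar, hsq,
    smul_smul]
  norm_num

variable (θ : ℝ) (F : Matrix (Fin r) (NoiseIdx k₁ k₂) ℂ)

theorem specΨ_conjTranspose : (specΨ F)ᴴ = -specΨ F := by
  simp only [specΨ, Matrix.conjTranspose_mul, Matrix.conjTranspose_conjTranspose,
    noiseJC_conjTranspose, Matrix.neg_mul, Matrix.mul_neg, Matrix.mul_assoc]

theorem smul_specΨ_conjTranspose : ((θ : ℂ) • specΨ F)ᴴ = -((θ : ℂ) • specΨ F) := by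
  rw [Matrix.conjTranspose_smul, specΨ_conjTranspose, Complex.star_def, Complex.conj_ofReal,
    smul_neg]

theorem isHermitian_two_I_smul {ι : Type*} {X : Matrix ι ι ℂ} (hX : Xᴴ = -X) :
    ((2 * Complex.I * (θ : ℂ)) • X).IsHermitian := by
  rw [Matrix.IsHermitian, Matrix.conjTranspose_smul, hX]
  simp

theorem isHermitian_phiΨ : (phiΨ θ F).IsHermitian := by
  rw [Matrix.IsHermitian, phiΨ, matPhi_conjTranspose,
    (isHermitian_two_I_smul θ (specΨ_conjTranspose F)).eq]

theorem specSigma_eq : specSigma θ F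
    = (F * itoRoot k₁ k₂)ᴴ * phiΨ θ F * (F * itoRoot k₁ k₂) := by
  simp only [specSigma, Matrix.conjTranspose_mul, itoRoot_conjTranspose, Matrix.mul_assoc]

theorem isHermitian_specDelta : (specDelta θ F).IsHermitian := by
  rw [specDelta, specSigma_eq]
  exact Matrix.isHermitian_one.sub
    ((Matrix.isHermitian_conjTranspose_mul_mul _ (isHermitian_phiΨ θ F)).smul
      (Complex.conj_ofReal θ))

theorem isHermitian_specSDS : (specSDS θ F).IsHermitian := by
  have h := Matrix.isHermitian_mul_mul_conjTranspose (itoRoot k₁ k₂) (isHermitian_specDelta θ F).inv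
  rwa [itoRoot_conjTranspose] at h

theorem specVarpi_eq_fderiv : specVarpi θ F
    = fderiv ℝ matPhi ((2 * Complex.I * (θ : ℂ)) • specΨ F) (F * specSDS θ F * Fᴴ) :=
  toBlocks₂₁_matPhi_lower _ _

theorem isHermitian_specVarpi : (specVarpi θ F).IsHermitian := by
  rw [Matrix.IsHermitian, specVarpi_eq_fderiv, fderiv_matPhi_conjTranspose,
    (isHermitian_two_I_smul θ (specΨ_conjTranspose F)).eq,
    (Matrix.isHermitian_mul_mul_conjTranspose F (isHermitian_specSDS θ F)).eq]

theorem frobInner_mul_mul {ι κ : Type*} [Fintype ι] [Fintype κ] {A : Matrix ι ι ℂ}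
    {B : Matrix κ κ ℂ} (hA : A.IsHermitian) (hB : B.IsHermitian) (X Y : Matrix ι κ ℂ) :
    frobInner X (A * Y * B) = frobInner (A * X * B) Y := by
  rw [frobInner, frobInner, ← Matrix.mul_assoc, Matrix.trace_mul_comm, Matrix.conjTranspose_mul,
    Matrix.conjTranspose_mul, hA.eq, hB.eq]
  simp only [Matrix.mul_assoc]

theorem frobInner_weighting (X Y : Matrix (Fin r) (NoiseIdx k₁ k₂) ℂ) :
    frobInner X (weighting θ F Y) = frobInner (weighting θ F X) Y := by
  have hφ := frobInner_mul_mul (isHermitian_phiΨ θ F) (isHermitian_specSDS θ F) X Y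
  have hϖ := frobInner_mul_mul (isHermitian_specVarpi θ F)
    (isHermitian_two_I_smul θ (noiseJC_conjTranspose k₁ k₂)) X Y
  simp only [frobInner] at hφ hϖ
  simp only [frobInner, weighting, LinearMap.coe_mk, AddHom.coe_mk, Matrix.mul_add,
    Matrix.conjTranspose_add, Matrix.add_mul, Matrix.trace_add, hφ, hϖ]

theorem det_specDelta : (specDelta θ F).det
    = (specD θ F).det * Complex.exp (Complex.I * ((θ : ℂ) • specΨ F).trace) := by
  have hS : F * itoRoot k₁ k₂ * (F * itoRoot k₁ k₂)ᴴ = specΦ F - Complex.I • specΨ F := by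
    rw [Matrix.conjTranspose_mul, itoRoot_conjTranspose, Matrix.mul_assoc,
      ← Matrix.mul_assoc (itoRoot k₁ k₂), itoRoot_mul_self, Matrix.sub_mul, Matrix.mul_sub,
      Matrix.one_mul, Matrix.smul_mul, Matrix.mul_smul, ← Matrix.mul_assoc]
    rfl
  have hWA : (specDelta θ F).det = (1 - ((θ : ℂ) • specΦ F - Complex.I • ((θ : ℂ) • specΨ F))
      * matPhi ((2 * Complex.I) • ((θ : ℂ) • specΨ F))).det := by
    rw [specDelta, specSigma_eq, ← Matrix.smul_mul, Matrix.det_one_sub_mul_comm, Matrix.mul_smul,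
      ← Matrix.mul_assoc, hS, smul_comm Complex.I, ← smul_sub, Matrix.smul_mul, smul_smul]
    rfl
  rw [hWA, det_one_sub_mul_matPhi (smul_specΨ_conjTranspose θ F), specD, Matrix.smul_mul]

theorem trace_specΨ_re : (specΨ F).trace.re = 0 := by
  have h := congrArg (fun X => X.trace.re) (specΨ_conjTranspose F)
  simp only [Matrix.trace_conjTranspose, Matrix.trace_neg, Complex.star_def, Complex.conj_re,
    Complex.neg_re] at h
  linarith

theorem det_specDelta_re : (specDelta θ F).det.re
    = (specD θ F).det.re * Real.exp (-(θ * (specΨ F).trace.im)) := by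
  have h : Complex.I * ((θ : ℂ) • specΨ F).trace = ((-(θ * (specΨ F).trace.im) : ℝ) : ℂ) := by
    apply Complex.ext <;> simp [Matrix.trace_smul, trace_specΨ_re]
  rw [det_specDelta, h, ← Complex.ofReal_exp, Complex.re_mul_ofReal]

theorem log_det_specD (h : 0 < (specDelta θ F).det.re) :
    Real.log (specD θ F).det.re
      = Real.log (specDelta θ F).det.re + θ * (specΨ F).trace.im := by
  rw [det_specDelta_re] at h ⊢
  rw [Real.log_mul (pos_of_mul_pos_left h (Real.exp_pos _).le).ne' (Real.exp_pos _).ne',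
    Real.log_exp, neg_add_cancel_right]

theorem det_specDelta_re_pos
    (h : ∀ x : ℝ, (x : ℂ) ∈ spectrum ℂ (specΦ F * matTanc ((θ : ℂ) • specΨ F)) → θ * x < 1) :
    0 < (specDelta θ F).det.re := by
  rw [det_specDelta_re]
  exact mul_pos (Complex.pos_iff.1 (det_matCos_sub_pos (smul_specΨ_conjTranspose θ F)
    (Matrix.isHermitian_mul_conjTranspose_self F) h)).1 (Real.exp_pos _)

theorem specDelta_zero : specDelta θ (0 : Matrix (Fin r) (NoiseIdx k₁ k₂) ℂ) = 1 := by
  simp [specDelta, specSigma]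

end SpectralAlgebra

section Norms

variable {ι κ : Type*} [Fintype ι] [Fintype κ]

theorem star_frobInner (X Y : Matrix ι κ ℂ) : star (frobInner X Y) = frobInner Y X := by
  rw [frobInner, frobInner, ← Matrix.trace_conjTranspose, Matrix.conjTranspose_mul,
    Matrix.conjTranspose_conjTranspose]

theorem frobNorm_eq_norm (X : Matrix ι κ ℂ) : frobNorm X = ‖X‖ := by
  have h : (frobInner X X).re = ∑ i, ∑ j, ‖X i j‖ ^ (2 : ℝ) := by
    rw [frobInner, Matrix.trace, Complex.re_sum, Finset.sum_comm]
    refine Finset.sum_congr rfl fun j _ => ?_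
    rw [Matrix.diag_apply, Matrix.mul_apply, Complex.re_sum]
    refine Finset.sum_congr rfl fun i _ => ?_
    rw [Matrix.conjTranspose_apply, Complex.star_def, ← Complex.normSq_eq_conj_mul_self,
      Complex.ofReal_re, Complex.normSq_eq_norm_sq, Real.rpow_two]
  rw [frobNorm, h, Matrix.frobenius_norm_def, Real.sqrt_eq_rpow]

/-- The real inner product `Re ⟨X, Y⟩` of complex matrices, as a continuous bilinear map. -/
noncomputable def reInner (ι κ : Type*) [Fintype ι] [Fintype κ] :
    Matrix ι κ ℂ →L[ℝ] Matrix ι κ ℂ →L[ℝ] ℝ :=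
  (LinearMap.mk₂ ℝ (fun X Y : Matrix ι κ ℂ => (frobInner X Y).re)
    (fun _ _ _ => by simp [frobInner, Matrix.add_mul])
    (fun _ _ _ => by simp [frobInner])
    (fun _ _ _ => by simp [frobInner, Matrix.mul_add])
    (fun _ _ _ => by simp [frobInner])).toContinuousBilinearMap

theorem reInner_apply (X Y : Matrix ι κ ℂ) : reInner ι κ X Y = (frobInner X Y).re := rfl

theorem reInner_comm (X Y : Matrix ι κ ℂ) : reInner ι κ X Y = reInner ι κ Y X := by
  rw [reInner_apply, reInner_apply, ← star_frobInner Y X, Complex.star_def, Complex.conj_re]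

theorem trace_mul_conjTranspose_add {A : Matrix ι ι ℂ} {B : Matrix κ κ ℂ} (hA : A.IsHermitian)
    (hB : B.IsHermitian) (V F : Matrix ι κ ℂ) :
    (B * (Vᴴ * A * F + Fᴴ * A * V)).trace = (2 * reInner ι κ (A * F * B) V : ℝ) := by
  have hV : (B * (Vᴴ * A * F)).trace = frobInner V (A * F * B) := by
    rw [Matrix.trace_mul_comm, frobInner]
    simp only [Matrix.mul_assoc]
  have hF : B * (Fᴴ * A * V) = (A * F * B)ᴴ * V := by
    simp only [Matrix.conjTranspose_mul, hA.eq, hB.eq, Matrix.mul_assoc]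
  rw [Matrix.mul_add, Matrix.trace_add, hV, hF, ← frobInner, ← star_frobInner V, Complex.star_def,
    Complex.add_conj, reInner_comm, reInner_apply]

theorem trace_mul_add_conjTranspose {A : Matrix ι ι ℂ} {B : Matrix κ κ ℂ} (hA : A.IsHermitian)
    (hB : B.IsHermitian) (V F : Matrix ι κ ℂ) :
    (A * (V * B * Fᴴ + F * B * Vᴴ)).trace = (2 * reInner ι κ (A * F * B) V : ℝ) := by
  have hcyclic (X Y : Matrix ι κ ℂ) : (A * (X * B * Yᴴ)).trace = (B * (Yᴴ * A * X)).trace := by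
    rw [← Matrix.mul_assoc, ← Matrix.mul_assoc, Matrix.mul_assoc _ B, Matrix.trace_mul_comm]
    simp only [Matrix.mul_assoc]
  rw [← trace_mul_conjTranspose_add hA hB, add_comm, Matrix.mul_add, Matrix.mul_add,
    Matrix.trace_add, Matrix.trace_add, hcyclic, hcyclic]

end Norms

/-! ### The derivative of the logarithm of the determinant -/

section Det

variable {ι : Type*} [Fintype ι] [DecidableEq ι]

theorem differentiable_det : Differentiable ℝ (Matrix.det : Matrix ι ι ℂ → ℂ) := by
  simp only [funext (Matrix.det_apply' (R := ℂ) (n := ι))]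
  refine Differentiable.fun_sum fun σ _ => Differentiable.const_mul (fun M => ?_) _
  exact (HasFDerivAt.finsetProd fun i _ =>
    (differentiable_matrix.1 differentiable_id (σ i) i M).hasFDerivAt).differentiableAt

theorem fderiv_det_apply {M : Matrix ι ι ℂ} (hM : IsUnit M.det) (V : Matrix ι ι ℂ) :
    fderiv ℝ Matrix.det M V = M.det * (M⁻¹ * V).trace := by
  have hline : HasDerivAt (fun t : ℝ => (M + t • V).det) (fderiv ℝ Matrix.det M V) 0 :=
    (differentiable_det M).hasFDerivAt.hasLineDerivAt V
  refine hline.unique ?_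
  set p := (1 + (Polynomial.X : Polynomial ℂ) • (M⁻¹ * V).map Polynomial.C).det.divX.divX
  have hpoly (t : ℝ) :
      (M + t • V).det = M.det * (1 + (M⁻¹ * V).trace * t + p.eval (t : ℂ) * (t : ℂ) ^ 2) := by
    rw [← Matrix.det_one_add_smul, ← Matrix.det_mul, mul_add, mul_one, Matrix.mul_smul,
      ← Matrix.mul_assoc, Matrix.mul_nonsing_inv _ hM, Matrix.one_mul]
    rfl
  simp only [hpoly]
  have hderiv := ((((hasDerivAt_id (0 : ℂ)).const_mul (M⁻¹ * V).trace).const_add 1).add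
    ((p.hasDerivAt (0 : ℂ)).mul (hasDerivAt_pow 2 (0 : ℂ)))).const_mul M.det
  exact HasDerivAt.comp_ofReal (z := 0) (by simpa using hderiv)

end Det

section LogDet

variable {k₁ k₂ r : ℕ} (θ : ℝ)

theorem differentiable_specΨ :
    Differentiable ℝ (specΨ : Matrix (Fin r) (NoiseIdx k₁ k₂) ℂ → Matrix (Fin r) (Fin r) ℂ) :=
  differentiable_matrix_mul (differentiable_matrix_mul differentiable_id (differentiable_const _))
    (differentiable_conjTranspose differentiable_id)

theorem fderiv_specΨ_apply (F V : Matrix (Fin r) (NoiseIdx k₁ k₂) ℂ) :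
    fderiv ℝ specΨ F V = V * noiseJC k₁ k₂ * Fᴴ + F * noiseJC k₁ k₂ * Vᴴ := by
  have hid := differentiableAt_id (𝕜 := ℝ) (x := F)
  have hJ := differentiableAt_const (𝕜 := ℝ) (x := F) (noiseJC k₁ k₂)
  have hFJ := (hasFDerivAt_matrix_mul hid hJ).differentiableAt
  have hF := (hasFDerivAt_conjTranspose hid).differentiableAt
  refine (fderiv_matrix_mul_apply hFJ hF V).trans ?_
  rw [fderiv_conjTranspose_apply hid, fderiv_matrix_mul_apply hid hJ, fderiv_fun_const,
    fderiv_id]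
  simp [add_comm]

theorem differentiable_phiΨ :
    Differentiable ℝ (phiΨ θ : Matrix (Fin r) (NoiseIdx k₁ k₂) ℂ → Matrix (Fin r) (Fin r) ℂ) :=
  differentiable_matPhi.comp (differentiable_specΨ.const_smul (2 * Complex.I * (θ : ℂ)))

theorem fderiv_phiΨ_apply (F V : Matrix (Fin r) (NoiseIdx k₁ k₂) ℂ) :
    fderiv ℝ (phiΨ θ) F V = fderiv ℝ matPhi ((2 * Complex.I * (θ : ℂ)) • specΨ F)
      ((2 * Complex.I * (θ : ℂ)) • fderiv ℝ specΨ F V) := by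
  have h := (differentiable_matPhi ((2 * Complex.I * (θ : ℂ)) • specΨ F)).hasFDerivAt.comp F
    ((differentiable_specΨ F).hasFDerivAt.const_smul (2 * Complex.I * (θ : ℂ)))
  exact congrArg (fun L => L V) h.fderiv

theorem specDelta_eq : (specDelta θ : Matrix (Fin r) (NoiseIdx k₁ k₂) ℂ → _) = fun F =>
    1 - (θ : ℂ) • (itoRoot k₁ k₂ * (Fᴴ * phiΨ θ F * F) * itoRoot k₁ k₂) := by
  funext F
  simp only [specDelta, specSigma, Matrix.mul_assoc]

theorem differentiable_conjTranspose_mul_phiΨ_mul : Differentiable ℝ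
    fun F : Matrix (Fin r) (NoiseIdx k₁ k₂) ℂ => Fᴴ * phiΨ θ F * F :=
  differentiable_matrix_mul (differentiable_matrix_mul
    (differentiable_conjTranspose differentiable_id) (differentiable_phiΨ θ))
    differentiable_id

theorem differentiable_specDelta : Differentiable ℝ (specDelta θ :
    Matrix (Fin r) (NoiseIdx k₁ k₂) ℂ → Matrix (NoiseIdx k₁ k₂) (NoiseIdx k₁ k₂) ℂ) := by
  rw [specDelta_eq]
  exact (differentiable_const _).sub ((differentiable_matrix_mul (differentiable_matrix_mul
    (differentiable_const _) (differentiable_conjTranspose_mul_phiΨ_mul θ))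
    (differentiable_const _)).const_smul (θ : ℂ))

theorem fderiv_conjTranspose_mul_phiΨ_mul_apply (F V : Matrix (Fin r) (NoiseIdx k₁ k₂) ℂ) :
    fderiv ℝ (fun F => Fᴴ * phiΨ θ F * F) F V
      = Vᴴ * phiΨ θ F * F + Fᴴ * phiΨ θ F * V + Fᴴ * fderiv ℝ (phiΨ θ) F V * F := by
  have hid := differentiableAt_id (𝕜 := ℝ) (x := F)
  have hF := (hasFDerivAt_conjTranspose hid).differentiableAt
  have hφ := differentiable_phiΨ θ F
  have hFφ := (hasFDerivAt_matrix_mul hF hφ).differentiableAt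
  refine (fderiv_matrix_mul_apply hFφ hid V).trans ?_
  rw [fderiv_matrix_mul_apply hF hφ, fderiv_conjTranspose_apply hid, fderiv_id]
  simp only [id, ContinuousLinearMap.id_apply, Matrix.add_mul]
  abel

theorem fderiv_specDelta_apply (F V : Matrix (Fin r) (NoiseIdx k₁ k₂) ℂ) :
    fderiv ℝ (specDelta θ) F V = -((θ : ℂ) • (itoRoot k₁ k₂
      * fderiv ℝ (fun F => Fᴴ * phiΨ θ F * F) F V * itoRoot k₁ k₂)) := by
  have hS := differentiableAt_const (𝕜 := ℝ) (x := F) (itoRoot k₁ k₂)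
  have hM := differentiable_conjTranspose_mul_phiΨ_mul θ F
  have hSM := (hasFDerivAt_matrix_mul hS hM).differentiableAt
  have hSMS := (hasFDerivAt_matrix_mul hSM hS).differentiableAt
  rw [specDelta_eq, fderiv_const_sub, fderiv_fun_const_smul hSMS]
  simp only [neg_apply, smul_apply, fderiv_matrix_mul_apply hSM hS, fderiv_matrix_mul_apply hS hM]
  simp

theorem trace_inv_specDelta_mul_fderiv (F V : Matrix (Fin r) (NoiseIdx k₁ k₂) ℂ) :
    ((specDelta θ F)⁻¹ * fderiv ℝ (specDelta θ) F V).trace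
      = (-(2 * θ) * reInner _ _ (weighting θ F F) V : ℝ) := by
  have hcyclic (M : Matrix (NoiseIdx k₁ k₂) (NoiseIdx k₁ k₂) ℂ) :
      ((specDelta θ F)⁻¹ * (itoRoot k₁ k₂ * M * itoRoot k₁ k₂)).trace
        = (specSDS θ F * M).trace := by
    rw [← Matrix.mul_assoc, Matrix.trace_mul_comm, specSDS]
    simp only [Matrix.mul_assoc]
  have hϖ : (specSDS θ F * (Fᴴ * fderiv ℝ (phiΨ θ) F V * F)).trace
      = (2 * reInner _ _ (specVarpi θ F * F * ((2 * Complex.I * (θ : ℂ)) • noiseJC k₁ k₂)) V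
          : ℝ) := by
    rw [← trace_mul_add_conjTranspose (isHermitian_specVarpi θ F)
      (isHermitian_two_I_smul θ (noiseJC_conjTranspose k₁ k₂)), specVarpi_eq_fderiv,
      ← trace_mul_fderiv_matPhi, fderiv_phiΨ_apply, fderiv_specΨ_apply, ← Matrix.mul_assoc,
      Matrix.trace_mul_comm]
    simp only [Matrix.mul_assoc, Matrix.mul_smul, Matrix.smul_mul, smul_add]
  have hweighting : weighting θ F F = phiΨ θ F * F * specSDS θ F
      + specVarpi θ F * F * ((2 * Complex.I * (θ : ℂ)) • noiseJC k₁ k₂) := rfl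
  rw [fderiv_specDelta_apply, Matrix.mul_neg, Matrix.mul_smul, Matrix.trace_neg,
    Matrix.trace_smul, hcyclic, fderiv_conjTranspose_mul_phiΨ_mul_apply, Matrix.mul_add,
    Matrix.trace_add, hϖ, trace_mul_conjTranspose_add (isHermitian_phiΨ θ F)
      (isHermitian_specSDS θ F), hweighting, map_add, add_apply, smul_eq_mul]
  push_cast
  ring

variable {θ} in
theorem isUnit_det_specDelta {F : Matrix (Fin r) (NoiseIdx k₁ k₂) ℂ}
    (hF : 0 < (specDelta θ F).det.re) : IsUnit (specDelta θ F).det := by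
  refine isUnit_iff_ne_zero.2 fun h => ?_
  simp [h] at hF

theorem hasFDerivAt_log_det_specDelta {F : Matrix (Fin r) (NoiseIdx k₁ k₂) ℂ}
    (hF : 0 < (specDelta θ F).det.re) :
    HasFDerivAt (fun F : Matrix (Fin r) (NoiseIdx k₁ k₂) ℂ => Real.log (specDelta θ F).det.re)
      (-(2 * θ) • reInner _ _ (weighting θ F F)) F := by
  have hlog := (Complex.reCLM.hasFDerivAt.comp F
    ((differentiable_det (specDelta θ F)).hasFDerivAt.comp F
      (differentiable_specDelta θ F).hasFDerivAt)).log hF.ne'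
  refine hlog.congr_fderiv (ContinuousLinearMap.ext fun V => ?_)
  change (specDelta θ F).det.re⁻¹
    * (fderiv ℝ Matrix.det (specDelta θ F) (fderiv ℝ (specDelta θ) F V)).re = _
  rw [fderiv_det_apply (isUnit_det_specDelta hF), trace_inv_specDelta_mul_fderiv,
    Complex.re_mul_ofReal, inv_mul_cancel_left₀ hF.ne']
  rfl

end LogDet

/-! ### Bounds on compact sets -/

section CompactBounds

theorem isBigO_norm_sq_of_hasFDerivAt {E : Type*} [NormedAddCommGroup E] [NormedSpace ℝ E]
    {f : E → ℝ} {f' : E → E →L[ℝ] ℝ} (hf0 : f 0 = 0) (hf : ∀ᶠ x in 𝓝 0, HasFDerivAt f (f' x) x)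
    (hf' : f' =O[𝓝 0] fun x => x) : f =O[𝓝 0] fun x => ‖x‖ ^ 2 := by
  obtain ⟨c, hc, hf'c⟩ := hf'.exists_pos
  obtain ⟨ρ, hρ, hball⟩ := Metric.nhds_basis_closedBall.mem_iff.1 (hf.and hf'c.bound)
  refine .of_bound c ?_
  filter_upwards [Metric.closedBall_mem_nhds 0 hρ] with x hx
  have hsub {y : E} (hy : y ∈ Metric.closedBall 0 ‖x‖) :
      HasFDerivAt f (f' y) y ∧ ‖f' y‖ ≤ c * ‖y‖ :=
    hball (Metric.closedBall_subset_closedBall (mem_closedBall_zero_iff.1 hx) hy)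
  have hmean := (convex_closedBall (0 : E) ‖x‖).norm_image_sub_le_of_norm_hasFDerivWithin_le
    (C := c * ‖x‖) (fun y hy => (hsub hy).1.hasFDerivWithinAt)
    (fun y hy => (hsub hy).2.trans (by gcongr; exact mem_closedBall_zero_iff.1 hy))
    (Metric.mem_closedBall_self (norm_nonneg x)) (y := x) (by simp)
  simpa [hf0, pow_two, mul_assoc] using hmean

theorem exists_norm_le_mul_norm_sq_of_isBigO {E F : Type*} [NormedAddCommGroup E]
    [NormedAddCommGroup F] {f : E → F} {K : Set E} (hK : IsCompact K) (hf : ContinuousOn f K)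
    (hf0 : f =O[𝓝 0] fun x => ‖x‖ ^ 2) : ∃ c : ℝ, ∀ x ∈ K, ‖f x‖ ≤ c * ‖x‖ ^ 2 := by
  obtain ⟨a, ha⟩ := hf0.bound
  obtain ⟨ρ, hρ, hball⟩ := Metric.nhds_basis_ball.mem_iff.1 ha
  obtain ⟨b, hb⟩ := hK.exists_bound_of_continuousOn hf
  refine ⟨max a (|b| / ρ ^ 2), fun x hx => ?_⟩
  rcases lt_or_ge ‖x‖ ρ with hxρ | hxρ
  · calc ‖f x‖ ≤ a * ‖x‖ ^ 2 := by simpa using hball (mem_ball_zero_iff.2 hxρ)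
      _ ≤ max a (|b| / ρ ^ 2) * ‖x‖ ^ 2 := by gcongr; exact le_max_left _ _
  · calc ‖f x‖ ≤ |b| := (hb x hx).trans (le_abs_self b)
      _ = |b| / ρ ^ 2 * ρ ^ 2 := by field_simp
      _ ≤ max a (|b| / ρ ^ 2) * ‖x‖ ^ 2 := by gcongr; exact le_max_right _ _

theorem continuousOn_matrix_mul {α ι κ μ 𝕜 : Type*} [TopologicalSpace α] [Fintype ι] [Fintype κ]
    [Fintype μ] [RCLike 𝕜] {f : α → Matrix ι κ 𝕜} {g : α → Matrix κ μ 𝕜} {s : Set α}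
    (hf : ContinuousOn f s) (hg : ContinuousOn g s) : ContinuousOn (fun x => f x * g x) s :=
  ((matrixMulL ι κ μ 𝕜).continuous.comp_continuousOn hf).clm_apply hg

variable {k₁ k₂ r : ℕ} (θ : ℝ)

/-- The set of values of the transfer matrix at which `det Δ_θ` is positive. -/
def posDomain (k₁ k₂ r : ℕ) (θ : ℝ) : Set (Matrix (Fin r) (NoiseIdx k₁ k₂) ℂ) :=
  {F | 0 < (specDelta θ F).det.re}

theorem isOpen_posDomain : IsOpen (posDomain k₁ k₂ r θ) :=
  isOpen_lt continuous_const (Complex.continuous_re.comp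
    (differentiable_det.continuous.comp (differentiable_specDelta θ).continuous))

theorem zero_mem_posDomain : (0 : Matrix (Fin r) (NoiseIdx k₁ k₂) ℂ) ∈ posDomain k₁ k₂ r θ := by
  simp [posDomain, specDelta_zero]

theorem continuousOn_specSDS : ContinuousOn (specSDS θ :
    Matrix (Fin r) (NoiseIdx k₁ k₂) ℂ → _) (posDomain k₁ k₂ r θ) := by
  have hinv : ContinuousOn (fun F : Matrix (Fin r) (NoiseIdx k₁ k₂) ℂ => (specDelta θ F)⁻¹)
      (posDomain k₁ k₂ r θ) := fun F hF =>
    (ContinuousAt.comp (f := specDelta θ) (continuousAt_matrix_inv _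
      (NormedRing.inverse_continuousAt (isUnit_det_specDelta hF).unit))
      (differentiable_specDelta θ).continuous.continuousAt).continuousWithinAt
  exact continuousOn_matrix_mul (continuousOn_matrix_mul continuousOn_const hinv)
    continuousOn_const

theorem continuousOn_specVarpi : ContinuousOn (specVarpi θ :
    Matrix (Fin r) (NoiseIdx k₁ k₂) ℂ → _) (posDomain k₁ k₂ r θ) := by
  have hFSDSF : ContinuousOn (fun F : Matrix (Fin r) (NoiseIdx k₁ k₂) ℂ => F * specSDS θ F * Fᴴ)
      (posDomain k₁ k₂ r θ) :=
    continuousOn_matrix_mul (continuousOn_matrix_mul continuousOn_id (continuousOn_specSDS θ))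
      (conjTransposeL _ _ ℂ).continuous.continuousOn
  have hΨ : ContinuousOn (fun F : Matrix (Fin r) (NoiseIdx k₁ k₂) ℂ =>
      (2 * Complex.I * (θ : ℂ)) • specΨ F) (posDomain k₁ k₂ r θ) :=
    (differentiable_specΨ.const_smul (2 * Complex.I * (θ : ℂ))).continuous.continuousOn
  have hblocks : ContinuousOn (fun F : Matrix (Fin r) (NoiseIdx k₁ k₂) ℂ =>
      Matrix.fromBlocks ((2 * Complex.I * (θ : ℂ)) • specΨ F) 0 (F * specSDS θ F * Fᴴ)
        ((2 * Complex.I * (θ : ℂ)) • specΨ F)) (posDomain k₁ k₂ r θ) := by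
    rw [continuousOn_iff_continuous_domRestrict] at hFSDSF hΨ ⊢
    exact Continuous.matrix_fromBlocks hΨ continuous_const hFSDSF hΨ
  have htoBlocks₂₁ : Continuous
      (Matrix.toBlocks₂₁ : Matrix (Fin r ⊕ Fin r) (Fin r ⊕ Fin r) ℂ → _) :=
    continuous_id.matrix_submatrix Sum.inr Sum.inl
  exact (htoBlocks₂₁.comp differentiable_matPhi.continuous).comp_continuousOn hblocks

/-- The weighting operator as a continuous real linear map. -/
noncomputable def weightingL (F : Matrix (Fin r) (NoiseIdx k₁ k₂) ℂ) :
    Matrix (Fin r) (NoiseIdx k₁ k₂) ℂ →L[ℝ] Matrix (Fin r) (NoiseIdx k₁ k₂) ℂ :=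
  ((weighting θ F).restrictScalars ℝ).toContinuousLinearMap

theorem continuousOn_weightingL : ContinuousOn (weightingL θ :
    Matrix (Fin r) (NoiseIdx k₁ k₂) ℂ → _) (posDomain k₁ k₂ r θ) :=
  continuousOn_clm_apply.2 fun _ => .add
    (continuousOn_matrix_mul (continuousOn_matrix_mul
      (differentiable_phiΨ θ).continuous.continuousOn continuousOn_const) (continuousOn_specSDS θ))
    (continuousOn_matrix_mul (continuousOn_matrix_mul (continuousOn_specVarpi θ)
      continuousOn_const) continuousOn_const)

theorem isBigO_reInner_weighting : (fun F : Matrix (Fin r) (NoiseIdx k₁ k₂) ℂ =>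
    -(2 * θ) • reInner _ _ (weighting θ F F)) =O[𝓝 0] fun F => F := by
  have hbdd : (weightingL θ : Matrix (Fin r) (NoiseIdx k₁ k₂) ℂ → _) =O[𝓝 0] fun _ => (1 : ℝ) :=
    ((continuousOn_weightingL θ).continuousAt
      ((isOpen_posDomain θ).mem_nhds (zero_mem_posDomain θ))).isBigO_one ℝ
  have happly : (fun F : Matrix (Fin r) (NoiseIdx k₁ k₂) ℂ => weighting θ F F)
      =O[𝓝 0] fun F => ‖weightingL θ F‖ * ‖F‖ :=
    .of_norm_le fun F => (weightingL θ F).le_opNorm F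
  refine (((reInner _ _).isBigO_comp _ _).trans (happly.trans ?_)).const_smul_left (-(2 * θ))
  refine .of_norm_right ?_
  simpa only [one_mul] using hbdd.norm_left.mul (Asymptotics.isBigO_refl (fun F => ‖F‖) _)

theorem exists_abs_log_det_le {K : Set (Matrix (Fin r) (NoiseIdx k₁ k₂) ℂ)} (hK : IsCompact K)
    (hKU : K ⊆ posDomain k₁ k₂ r θ) :
    ∃ c : ℝ, ∀ F ∈ K, ‖Real.log (specDelta θ F).det.re‖ ≤ c * ‖F‖ ^ 2 := by
  refine exists_norm_le_mul_norm_sq_of_isBigO hK (fun F hF =>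
    (hasFDerivAt_log_det_specDelta θ (hKU hF)).continuousAt.continuousWithinAt)
    (isBigO_norm_sq_of_hasFDerivAt (by simp [specDelta_zero]) ?_ (isBigO_reInner_weighting θ))
  filter_upwards [(isOpen_posDomain θ).mem_nhds (zero_mem_posDomain θ)] with F hF
  exact hasFDerivAt_log_det_specDelta θ hF

end CompactBounds

/-! ### Resolvents on the imaginary axis -/

/-- The function `(1 + |λ|)⁻¹`, which controls the decay of resolvents and transfer matrices along
the imaginary axis. -/
noncomputable def decay (l : ℝ) : ℝ := (1 + |l|)⁻¹

theorem decay_pos (l : ℝ) : 0 < decay l := by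
  unfold decay
  positivity

theorem decay_le_one (l : ℝ) : decay l ≤ 1 :=
  inv_le_one_of_one_le₀ (le_add_of_nonneg_right (abs_nonneg l))

theorem integrable_decay_sq : Integrable fun l => decay l ^ 2 := by
  have h := integrable_one_add_norm (E := ℝ) (μ := volume) (r := 2) (by simp)
  refine h.congr (.of_forall fun l => ?_)
  simp only [decay, Real.norm_eq_abs, inv_pow]
  rw [Real.rpow_neg (by positivity), Real.rpow_two]

theorem tendsto_decay : Tendsto decay (cocompact ℝ) (𝓝 0) :=
  tendsto_inv_atTop_zero.comp (tendsto_atTop_add_const_left _ _ tendsto_norm_cocompact_atTop)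

section Resolvent

variable {A : Type*} [NormedRing A] [NormedAlgebra ℂ A] [CompleteSpace A] {a : A}

theorem continuous_resolvent_I_mul (h : ∀ l : ℝ, Complex.I * l ∈ resolventSet ℂ a) :
    Continuous fun l : ℝ => resolvent a (Complex.I * l) :=
  continuous_iff_continuousAt.2 fun l =>
    ContinuousAt.comp (f := fun l : ℝ => Complex.I * (l : ℂ))
      (spectrum.hasDerivAt_resolvent_const_left (h l)).continuousAt
      (Continuous.continuousAt (by fun_prop))

theorem isBigO_resolvent_I_mul (a : A) :
    (fun l : ℝ => resolvent a (Complex.I * l)) =O[cocompact ℝ] fun l => l⁻¹ := by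
  have htendsto : Tendsto (fun l : ℝ => Complex.I * (l : ℂ)) (cocompact ℝ)
      (Bornology.cobounded ℂ) :=
    tendsto_norm_atTop_iff_cobounded.1
      (tendsto_norm_cocompact_atTop.congr fun l => by simp)
  exact ((spectrum.resolvent_isBigO_inv a).comp_tendsto htendsto).trans
    (.of_bound 1 (.of_forall fun l => by simp))

theorem exists_norm_resolvent_le (h : ∀ l : ℝ, Complex.I * l ∈ resolventSet ℂ a) :
    ∃ c > 0, ∀ l : ℝ, ‖resolvent a (Complex.I * l)‖ ≤ c * decay l := by
  have hcont : Continuous fun l : ℝ => (1 + |l|) * ‖resolvent a (Complex.I * l)‖ :=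
    (continuous_const.add continuous_abs).mul (continuous_resolvent_I_mul h).norm
  have hweight : (fun l : ℝ => 1 + |l|) =O[cocompact ℝ] fun l => l := by
    rw [← Metric.cobounded_eq_cocompact]
    have hone : (fun _ : ℝ => (1 : ℝ)) =O[Bornology.cobounded ℝ] fun l => l :=
      (Asymptotics.isLittleO_const_id_cobounded 1).isBigO
    exact hone.add (Asymptotics.isBigO_refl _ _).abs_left
  have hbounded : (fun l : ℝ => (1 + |l|) * ‖resolvent a (Complex.I * l)‖) =O[cocompact ℝ]
      (1 : ℝ → ℝ) :=
    (hweight.mul (isBigO_resolvent_I_mul a).norm_left).trans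
      (.of_norm_le fun l => by simpa using mul_inv_le_one)
  obtain ⟨c, hc, hle⟩ := (hcont.isBounded_range_iff_isBigO.2 hbounded).exists_pos_norm_le
  refine ⟨c, hc, fun l => ?_⟩
  rw [decay, ← div_eq_mul_inv, le_div_iff₀' (by positivity)]
  exact (le_abs_self _).trans (hle _ ⟨l, rfl⟩)

theorem mem_resolventSet_of_norm_mul_lt_one {a' : A} {z : ℂ} (hz : z ∈ resolventSet ℂ a)
    (h : ‖resolvent a z * (a' - a)‖ < 1) : z ∈ resolventSet ℂ a' := by
  have hfactor : algebraMap ℂ A z - a' =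
      (algebraMap ℂ A z - a) * (1 - resolvent a z * (a' - a)) := by
    rw [mul_sub, mul_one, ← mul_assoc, resolvent, Ring.mul_inverse_cancel _ hz, one_mul]
    abel
  rw [spectrum.mem_resolventSet_iff, hfactor]
  exact IsUnit.mul hz (isUnit_one_sub_of_norm_lt_one h)

theorem eventually_norm_resolvent_le (h : ∀ l : ℝ, Complex.I * l ∈ resolventSet ℂ a) :
    ∃ c > 0, ∀ᶠ a' in 𝓝 a, ∀ l : ℝ, Complex.I * l ∈ resolventSet ℂ a' ∧
      ‖resolvent a' (Complex.I * l)‖ ≤ c * decay l := by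
  obtain ⟨c, hc, hle⟩ := exists_norm_resolvent_le h
  refine ⟨2 * c, by positivity, ?_⟩
  filter_upwards [Metric.ball_mem_nhds a (inv_pos.2 (mul_pos two_pos hc))] with a' ha' l
  have hdist : ‖a' - a‖ ≤ (2 * c)⁻¹ := (mem_ball_iff_norm.1 ha').le
  have hsmall : ‖a' - a‖ * ‖resolvent a (Complex.I * l)‖ ≤ 1 / 2 :=
    calc ‖a' - a‖ * ‖resolvent a (Complex.I * l)‖
        ≤ (2 * c)⁻¹ * (c * 1) := by
          gcongr
          exact (hle l).trans (by gcongr; exact decay_le_one l)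
      _ = 1 / 2 := by field_simp
  have hmem : Complex.I * l ∈ resolventSet ℂ a' :=
    mem_resolventSet_of_norm_mul_lt_one (h l) ((norm_mul_le _ _).trans_lt (by linarith))
  have hsub : ‖resolvent a' (Complex.I * l)‖ - ‖resolvent a (Complex.I * l)‖
      ≤ ‖resolvent a' (Complex.I * l)‖ * (1 / 2) :=
    calc _ ≤ ‖resolvent a' (Complex.I * l) - resolvent a (Complex.I * l)‖ := norm_sub_norm_le _ _
      _ ≤ ‖resolvent a' (Complex.I * l)‖ * (‖a' - a‖ * ‖resolvent a (Complex.I * l)‖) := by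
          rw [spectrum.resolvent_sub_resolvent hmem (h l), mul_assoc]
          exact (norm_mul_le _ _).trans (by gcongr; exact norm_mul_le _ _)
      _ ≤ _ := by gcongr
  exact ⟨hmem, by linarith [hle l]⟩

end Resolvent

/-! ### The transfer matrix near a stable system -/

section Transfer

theorem frobenius_norm_mul_mul_le {ι κ μ ρ 𝕜 : Type*} [Fintype ι] [Fintype κ] [Fintype μ]
    [Fintype ρ] [RCLike 𝕜] (X : Matrix ι κ 𝕜) (Y : Matrix κ μ 𝕜) (Z : Matrix μ ρ 𝕜) :
    ‖X * Y * Z‖ ≤ ‖X‖ * ‖Y‖ * ‖Z‖ :=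
  (Matrix.frobenius_norm_mul _ _).trans (by gcongr; exact Matrix.frobenius_norm_mul _ _)

/-- The embedding of real matrices into complex ones as a continuous linear map. -/
noncomputable def ofRealL (ι κ : Type*) [Fintype ι] [Fintype κ] :
    Matrix ι κ ℝ →L[ℝ] Matrix ι κ ℂ :=
  (Complex.ofRealAm.toLinearMap.mapMatrix (m := ι) (n := κ)).toContinuousLinearMap

theorem norm_ofRealL_apply {ι κ : Type*} [Fintype ι] [Fintype κ] (M : Matrix ι κ ℝ) :
    ‖ofRealL ι κ M‖ = ‖M‖ :=
  Matrix.frobenius_norm_map_eq M Complex.ofReal Complex.norm_real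

variable {n ν k₁ k₂ r : ℕ}

/-- The complexified state matrix `𝒜` of the closed-loop system. -/
noncomputable def loopA :
    LoopMatrices n ν k₁ k₂ r →L[ℝ] Matrix (Fin n ⊕ Fin ν) (Fin n ⊕ Fin ν) ℂ :=
  (ofRealL _ _).comp (ContinuousLinearMap.fst ℝ _ _)

/-- The complexified input matrix `ℬ` of the closed-loop system. -/
noncomputable def loopB :
    LoopMatrices n ν k₁ k₂ r →L[ℝ] Matrix (Fin n ⊕ Fin ν) (NoiseIdx k₁ k₂) ℂ :=
  (ofRealL _ _).comp ((ContinuousLinearMap.fst ℝ _ _).comp (ContinuousLinearMap.snd ℝ _ _))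

/-- The complexified output matrix `𝒞` of the closed-loop system. -/
noncomputable def loopC :
    LoopMatrices n ν k₁ k₂ r →L[ℝ] Matrix (Fin r) (Fin n ⊕ Fin ν) ℂ :=
  (ofRealL _ _).comp ((ContinuousLinearMap.snd ℝ _ _).comp (ContinuousLinearMap.snd ℝ _ _))

variable (Γ V : LoopMatrices n ν k₁ k₂ r)

theorem norm_loopA_le : ‖loopA Γ‖ ≤ ‖Γ‖ :=
  (norm_ofRealL_apply Γ.1).le.trans (norm_fst_le Γ)

theorem norm_loopB_le : ‖loopB Γ‖ ≤ ‖Γ‖ :=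
  (norm_ofRealL_apply Γ.2.1).le.trans ((norm_fst_le Γ.2).trans (norm_snd_le Γ))

theorem norm_loopC_le : ‖loopC Γ‖ ≤ ‖Γ‖ :=
  (norm_ofRealL_apply Γ.2.2).le.trans ((norm_snd_le Γ.2).trans (norm_snd_le Γ))

/-- The resolvent `(iλI - 𝒜)⁻¹` of the state matrix of the closed-loop system. -/
noncomputable def loopR (l : ℝ) : Matrix (Fin n ⊕ Fin ν) (Fin n ⊕ Fin ν) ℂ :=
  resolvent (loopA Γ) (Complex.I * (l : ℂ))

theorem freq_eq (l : ℝ) : freq Γ l = loopC Γ * loopR Γ l * loopB Γ := by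
  rw [loopR, resolvent, ← Matrix.nonsing_inv_eq_ringInverse, Algebra.algebraMap_eq_smul_one]
  rfl

/-- The frequency `λ` is not a pole of the transfer matrix of the closed-loop system. -/
def IsRegularFreq (l : ℝ) : Prop := Complex.I * (l : ℂ) ∈ resolventSet ℂ (loopA Γ)

variable {Γ}

theorem IsHurwitz.isRegularFreq (h : IsHurwitz Γ) (l : ℝ) : IsRegularFreq Γ l := by
  by_contra hl
  simpa using h _ hl

theorem hasFDerivAt_loopR {l : ℝ} (h : IsRegularFreq Γ l) :
    HasFDerivAt (fun Γ => loopR Γ l)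
      (((ContinuousLinearMap.mulLeftRight ℂ _ (loopR Γ l) (loopR Γ l)).restrictScalars ℝ).comp
        loopA) Γ :=
  (spectrum.hasFDerivAt_resolvent h).restrictScalars ℝ |>.comp Γ loopA.hasFDerivAt

theorem differentiableAt_freq {l : ℝ} (h : IsRegularFreq Γ l) :
    DifferentiableAt ℝ (fun Γ => freq Γ l) Γ := by
  simp only [freq_eq]
  exact (hasFDerivAt_matrix_mul (hasFDerivAt_matrix_mul loopC.differentiableAt
    (hasFDerivAt_loopR h).differentiableAt).differentiableAt
    loopB.differentiableAt).differentiableAt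

theorem fderiv_freq_apply {l : ℝ} (h : IsRegularFreq Γ l) :
    fderiv ℝ (fun Γ => freq Γ l) Γ V = loopC Γ * loopR Γ l * loopB V
      + (loopC Γ * (loopR Γ l * loopA V * loopR Γ l) * loopB Γ
        + loopC V * loopR Γ l * loopB Γ) := by
  have hR := hasFDerivAt_loopR h
  simp only [freq_eq]
  rw [fderiv_matrix_mul_apply (hasFDerivAt_matrix_mul loopC.differentiableAt
    hR.differentiableAt).differentiableAt loopB.differentiableAt,
    fderiv_matrix_mul_apply loopC.differentiableAt hR.differentiableAt, hR.fderiv,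
    loopB.fderiv, loopC.fderiv, Matrix.add_mul]
  rfl

theorem continuous_freq (h : ∀ l, IsRegularFreq Γ l) : Continuous (freq Γ) := by
  have hR : Continuous (loopR Γ) := continuous_resolvent_I_mul h
  simp only [funext (freq_eq Γ), ← continuousOn_univ] at hR ⊢
  exact continuousOn_matrix_mul (continuousOn_matrix_mul continuousOn_const hR) continuousOn_const

theorem continuous_fderiv_freq (h : ∀ l, IsRegularFreq Γ l) :
    Continuous fun l => fderiv ℝ (fun Γ => freq Γ l) Γ := by
  have hR : Continuous (loopR Γ) := continuous_resolvent_I_mul h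
  refine continuous_clm_apply.2 fun V => ?_
  simp only [fun l => fderiv_freq_apply V (h l), ← continuousOn_univ] at hR ⊢
  have hmul {ι κ : Type} [Fintype ι] [Fintype κ] (X : Matrix ι (Fin n ⊕ Fin ν) ℂ)
      {Y : ℝ → Matrix (Fin n ⊕ Fin ν) (Fin n ⊕ Fin ν) ℂ} (hY : ContinuousOn Y Set.univ)
      (Z : Matrix (Fin n ⊕ Fin ν) κ ℂ) : ContinuousOn (fun l => X * Y l * Z) Set.univ :=
    continuousOn_matrix_mul (continuousOn_matrix_mul continuousOn_const hY) continuousOn_const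
  exact (hmul _ hR _).add ((hmul _ (continuousOn_matrix_mul (continuousOn_matrix_mul hR
    continuousOn_const) hR) _).add (hmul _ hR _))

theorem norm_freq_le (l : ℝ) : ‖freq Γ l‖ ≤ ‖Γ‖ ^ 2 * ‖loopR Γ l‖ :=
  calc ‖freq Γ l‖ ≤ ‖loopC Γ‖ * ‖loopR Γ l‖ * ‖loopB Γ‖ := by
        rw [freq_eq]
        exact frobenius_norm_mul_mul_le _ _ _
    _ ≤ ‖Γ‖ * ‖loopR Γ l‖ * ‖Γ‖ := by
        gcongr
        exacts [norm_loopC_le Γ, norm_loopB_le Γ]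
    _ = ‖Γ‖ ^ 2 * ‖loopR Γ l‖ := by ring

theorem norm_fderiv_freq_le {l : ℝ} (h : IsRegularFreq Γ l) :
    ‖fderiv ℝ (fun Γ => freq Γ l) Γ‖ ≤ ‖Γ‖ * (2 + ‖Γ‖ * ‖loopR Γ l‖) * ‖loopR Γ l‖ := by
  refine ContinuousLinearMap.opNorm_le_bound _ (by positivity) fun V => ?_
  calc ‖fderiv ℝ (fun Γ => freq Γ l) Γ V‖
      ≤ ‖loopC Γ‖ * ‖loopR Γ l‖ * ‖loopB V‖
        + (‖loopC Γ‖ * (‖loopR Γ l‖ * ‖loopA V‖ * ‖loopR Γ l‖) * ‖loopB Γ‖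
          + ‖loopC V‖ * ‖loopR Γ l‖ * ‖loopB Γ‖) := by
        rw [fderiv_freq_apply V h]
        refine norm_add_le_of_le (frobenius_norm_mul_mul_le _ _ _) (norm_add_le_of_le
          ((frobenius_norm_mul_mul_le _ _ _).trans ?_) (frobenius_norm_mul_mul_le _ _ _))
        gcongr
        exact frobenius_norm_mul_mul_le _ _ _
    _ ≤ ‖Γ‖ * ‖loopR Γ l‖ * ‖V‖ + (‖Γ‖ * (‖loopR Γ l‖ * ‖V‖ * ‖loopR Γ l‖) * ‖Γ‖
          + ‖V‖ * ‖loopR Γ l‖ * ‖Γ‖) := by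
        gcongr
        exacts [norm_loopC_le Γ, norm_loopB_le V, norm_loopC_le Γ, norm_loopA_le V,
          norm_loopB_le Γ, norm_loopC_le V, norm_loopB_le Γ]
    _ = _ := by ring

theorem IsHurwitz.eventually_norm_freq_le {Γ₀ : LoopMatrices n ν k₁ k₂ r} (h₀ : IsHurwitz Γ₀) :
    ∃ c > 0, ∀ᶠ Γ in 𝓝 Γ₀, ∀ l, IsRegularFreq Γ l ∧ ‖freq Γ l‖ ≤ c * decay l ∧
      ‖fderiv ℝ (fun Γ => freq Γ l) Γ‖ ≤ c * decay l := by
  obtain ⟨c, hc, hev⟩ := eventually_norm_resolvent_le h₀.isRegularFreq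
  set m := ‖Γ₀‖ + 1
  refine ⟨m ^ 2 * c + m * (2 + m * c) * c, by positivity, ?_⟩
  filter_upwards [loopA.continuous.continuousAt.eventually hev,
    continuous_norm.continuousAt.eventually_le_const (lt_add_one ‖Γ₀‖)] with Γ hΓ hm l
  obtain ⟨hreg, hR⟩ : IsRegularFreq Γ l ∧ ‖loopR Γ l‖ ≤ c * decay l := hΓ l
  have hRc : ‖loopR Γ l‖ ≤ c := hR.trans (mul_le_of_le_one_right hc.le (decay_le_one l))
  have hd := decay_pos l
  refine ⟨hreg, ?_, ?_⟩
  · calc ‖freq Γ l‖ ≤ m ^ 2 * (c * decay l) := (norm_freq_le l).trans (by gcongr)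
      _ = m ^ 2 * c * decay l := by ring
      _ ≤ _ := by gcongr; exact le_add_of_nonneg_right (by positivity)
  · calc ‖fderiv ℝ (fun Γ => freq Γ l) Γ‖ ≤ m * (2 + m * c) * (c * decay l) :=
          (norm_fderiv_freq_le hreg).trans (by gcongr)
      _ = m * (2 + m * c) * c * decay l := by ring
      _ ≤ _ := by gcongr; exact le_add_of_nonneg_left (by positivity)

theorem IsHurwitz.tendstoUniformly_freq {Γ₀ : LoopMatrices n ν k₁ k₂ r} (h₀ : IsHurwitz Γ₀) :
    TendstoUniformly freq (freq Γ₀) (𝓝 Γ₀) := by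
  obtain ⟨c, hc, hev⟩ := h₀.eventually_norm_freq_le
  obtain ⟨ρ, hρ, hball⟩ := Metric.mem_nhds_iff.1 hev
  refine Metric.tendstoUniformly_iff.2 fun δ hδ => ?_
  filter_upwards [Metric.ball_mem_nhds Γ₀ (lt_min hρ (div_pos hδ hc))] with Γ hΓ l
  have hmean : ‖freq Γ l - freq Γ₀ l‖ ≤ c * ‖Γ - Γ₀‖ :=
    (convex_ball Γ₀ ρ).norm_image_sub_le_of_norm_fderiv_le (𝕜 := ℝ)
      (f := fun Γ => freq Γ l) (C := c)
      (fun Γ' hΓ' => differentiableAt_freq (hball hΓ' l).1)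
      (fun Γ' hΓ' => (hball hΓ' l).2.2.trans (mul_le_of_le_one_right hc.le (decay_le_one l)))
      (Metric.mem_ball_self hρ) (Metric.ball_subset_ball (min_le_left _ _) hΓ)
  rw [dist_comm, dist_eq_norm]
  calc ‖freq Γ l - freq Γ₀ l‖ ≤ c * ‖Γ - Γ₀‖ := hmean
    _ < c * (δ / c) := by
        gcongr
        exact (mem_ball_iff_norm.1 hΓ).trans_le (min_le_right _ _)
    _ = δ := by field_simp

theorem IsHurwitz.exists_isCompact_freq_mem {Γ₀ : LoopMatrices n ν k₁ k₂ r} (h₀ : IsHurwitz Γ₀)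
    {U : Set (Matrix (Fin r) (NoiseIdx k₁ k₂) ℂ)} (hU : IsOpen U) (h0U : 0 ∈ U)
    (hfU : ∀ l, freq Γ₀ l ∈ U) :
    ∃ K, IsCompact K ∧ K ⊆ U ∧ ∀ᶠ Γ in 𝓝 Γ₀, ∀ l, freq Γ l ∈ K := by
  obtain ⟨c, -, hev⟩ := h₀.eventually_norm_freq_le
  have htendsto : Tendsto (freq Γ₀) (cocompact ℝ) (𝓝 0) :=
    squeeze_zero_norm (fun l => (hev.self_of_nhds l).2.1) (by simpa using tendsto_decay.const_mul c)
  have hrange : IsCompact (insert 0 (Set.range (freq Γ₀))) :=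
    htendsto.isCompact_insert_range_of_cocompact (continuous_freq h₀.isRegularFreq)
  have : ProperSpace (Matrix (Fin r) (NoiseIdx k₁ k₂) ℂ) := FiniteDimensional.proper_real _
  obtain ⟨δ, hδ, hsub⟩ := hrange.exists_cthickening_subset_open hU
    (Set.insert_subset h0U (Set.range_subset_iff.2 hfU))
  refine ⟨_, hrange.cthickening, hsub, ?_⟩
  filter_upwards [Metric.tendstoUniformly_iff.1 h₀.tendstoUniformly_freq δ hδ] with Γ hΓ l
  exact Metric.mem_cthickening_of_dist_le _ (freq Γ₀ l) δ _ (.inr ⟨l, rfl⟩)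
    ((dist_comm _ _).trans_le (hΓ l).le)

end Transfer

/-! ### Differentiation of frequency-domain integrals -/

section Integrals

variable {n ν k₁ k₂ r : ℕ} {Γ₀ : LoopMatrices n ν k₁ k₂ r}

section Dominated

variable {K : Set (Matrix (Fin r) (NoiseIdx k₁ k₂) ℂ)} {E : Type*} [NormedAddCommGroup E]

theorem continuous_comp_freq {g : ℝ → Matrix (Fin r) (NoiseIdx k₁ k₂) ℂ → E}
    (hg : ContinuousOn (Function.uncurry g) (Set.univ ×ˢ K)) {Γ : LoopMatrices n ν k₁ k₂ r}
    (hΓ : ∀ l, IsRegularFreq Γ l) (hΓK : ∀ l, freq Γ l ∈ K) :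
    Continuous fun l => g l (freq Γ l) :=
  hg.comp_continuous (continuous_id.prodMk (continuous_freq hΓ)) fun l => ⟨trivial, hΓK l⟩

theorem IsHurwitz.eventually_integrable_freq (h₀ : IsHurwitz Γ₀)
    (hK : ∀ᶠ Γ in 𝓝 Γ₀, ∀ l, freq Γ l ∈ K)
    {g : ℝ → Matrix (Fin r) (NoiseIdx k₁ k₂) ℂ → E} {C : ℝ}
    (hg : ContinuousOn (Function.uncurry g) (Set.univ ×ˢ K))
    (hgC : ∀ l, ∀ F ∈ K, ‖g l F‖ ≤ C * ‖F‖ ^ 2) :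
    ∀ᶠ Γ in 𝓝 Γ₀, Integrable fun l => g l (freq Γ l) := by
  obtain ⟨c, -, hev⟩ := h₀.eventually_norm_freq_le
  filter_upwards [hev, hK] with Γ hΓ hΓK
  refine (integrable_decay_sq.const_mul (|C| * c ^ 2)).mono'
    (continuous_comp_freq hg (fun l => (hΓ l).1) hΓK).aestronglyMeasurable (.of_forall fun l => ?_)
  calc ‖g l (freq Γ l)‖ ≤ |C| * ‖freq Γ l‖ ^ 2 :=
        (hgC l _ (hΓK l)).trans (by gcongr; exact le_abs_self C)
    _ ≤ |C| * (c * decay l) ^ 2 := by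
        gcongr
        exact (hΓ l).2.1
    _ = |C| * c ^ 2 * decay l ^ 2 := by ring

theorem IsHurwitz.hasFDerivAt_integral_freq (h₀ : IsHurwitz Γ₀)
    (hK : ∀ᶠ Γ in 𝓝 Γ₀, ∀ l, freq Γ l ∈ K) {g : ℝ → Matrix (Fin r) (NoiseIdx k₁ k₂) ℂ → ℝ}
    {g' : ℝ → Matrix (Fin r) (NoiseIdx k₁ k₂) ℂ → Matrix (Fin r) (NoiseIdx k₁ k₂) ℂ →L[ℝ] ℝ}
    {C C' : ℝ} (hgg' : ∀ l, ∀ F ∈ K, HasFDerivAt (g l) (g' l F) F)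
    (hg : ContinuousOn (Function.uncurry g) (Set.univ ×ˢ K))
    (hg' : ContinuousOn (Function.uncurry g') (Set.univ ×ˢ K))
    (hgC : ∀ l, ∀ F ∈ K, ‖g l F‖ ≤ C * ‖F‖ ^ 2) (hgC' : ∀ l, ∀ F ∈ K, ‖g' l F‖ ≤ C' * ‖F‖) :
    HasFDerivAt (fun Γ => ∫ l, g l (freq Γ l))
      (∫ l, (g' l (freq Γ₀ l)).comp (fderiv ℝ (fun Γ => freq Γ l) Γ₀)) Γ₀ := by
  obtain ⟨c, -, hev⟩ := h₀.eventually_norm_freq_le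
  refine hasFDerivAt_integral_of_dominated_of_fderiv_le (μ := volume)
    (F := fun Γ l => g l (freq Γ l))
    (F' := fun Γ l => (g' l (freq Γ l)).comp (fderiv ℝ (fun Γ => freq Γ l) Γ))
    (bound := fun l => |C'| * c ^ 2 * decay l ^ 2) (hev.and hK) ?_
    (h₀.eventually_integrable_freq hK hg hgC).self_of_nhds
    ((continuous_comp_freq hg' h₀.isRegularFreq hK.self_of_nhds).clm_comp
      (continuous_fderiv_freq h₀.isRegularFreq)).aestronglyMeasurable
    (.of_forall fun l Γ ⟨hΓ, hΓK⟩ => ?_) (integrable_decay_sq.const_mul _)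
    (.of_forall fun l Γ ⟨hΓ, hΓK⟩ =>
      (hgg' l _ (hΓK l)).comp Γ (differentiableAt_freq (hΓ l).1).hasFDerivAt)
  · filter_upwards [hev, hK] with Γ hΓ hΓK
    exact (continuous_comp_freq hg (fun l => (hΓ l).1) hΓK).aestronglyMeasurable
  · have hnorm : ‖g' l (freq Γ l)‖ ≤ |C'| * (c * decay l) :=
      (hgC' l _ (hΓK l)).trans (mul_le_mul (le_abs_self C') (hΓ l).2.1 (norm_nonneg _)
        (abs_nonneg C'))
    calc ‖(g' l (freq Γ l)).comp (fderiv ℝ (fun Γ => freq Γ l) Γ)‖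
        ≤ ‖g' l (freq Γ l)‖ * ‖fderiv ℝ (fun Γ => freq Γ l) Γ‖ :=
          ContinuousLinearMap.opNorm_comp_le _ _
      _ ≤ (|C'| * (c * decay l)) * (c * decay l) :=
          mul_le_mul hnorm (hΓ l).2.2 (norm_nonneg _) ((norm_nonneg _).trans hnorm)
      _ = |C'| * c ^ 2 * decay l ^ 2 := by ring

end Dominated

/-! ### The weighted quadratic cost -/

section WeightedCost

variable {𝔐 : ℝ → Matrix (Fin r) (NoiseIdx k₁ k₂) ℂ →ₗ[ℂ] Matrix (Fin r) (NoiseIdx k₁ k₂) ℂ}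
  {a : ℝ}

theorem hasFDerivAt_reInner_self {ι κ : Type*} [Fintype ι] [Fintype κ]
    {T : Matrix ι κ ℂ →ₗ[ℂ] Matrix ι κ ℂ}
    (hT : ∀ X Y, frobInner X (T Y) = frobInner (T X) Y) (F : Matrix ι κ ℂ) :
    HasFDerivAt (fun F => reInner ι κ F (T F)) ((2 : ℝ) • reInner ι κ (T F)) F := by
  have hbilin := (reInner ι κ).hasFDerivAt_of_bilinear (hasFDerivAt_id F)
    (T.restrictScalars ℝ).toContinuousLinearMap.hasFDerivAt
  refine hbilin.congr_fderiv (ContinuousLinearMap.ext fun V => ?_)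
  change reInner ι κ F (T V) + reInner ι κ V (T F) = 2 * reInner ι κ (T F) V
  rw [reInner_apply, hT, ← reInner_apply, reInner_comm V, two_mul]

theorem weightedDensity_eq_reInner
    (hsymm : ∀ l X Y, frobInner X (𝔐 l Y) = frobInner (𝔐 l X) Y)
    (Γ : LoopMatrices n ν k₁ k₂ r) (l : ℝ) :
    weightedDensity 𝔐 Γ l = (reInner _ _ (freq Γ l) (𝔐 l (freq Γ l)) : ℝ) := by
  refine (Complex.conj_eq_iff_re.1 ?_).symm
  rw [weightedDensity, ← Complex.star_def, star_frobInner, hsymm]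

theorem norm_reInner_le (hbdd : ∀ l X, ‖𝔐 l X‖ ≤ a * ‖X‖) (l : ℝ)
    (F : Matrix (Fin r) (NoiseIdx k₁ k₂) ℂ) :
    ‖reInner _ _ (𝔐 l F)‖ ≤ ‖reInner (Fin r) (NoiseIdx k₁ k₂)‖ * a * ‖F‖ :=
  ((reInner _ _).le_opNorm_of_le (hbdd l F)).trans_eq (mul_assoc _ _ _).symm

theorem norm_reInner_self_le (hbdd : ∀ l X, ‖𝔐 l X‖ ≤ a * ‖X‖) (l : ℝ)
    (F : Matrix (Fin r) (NoiseIdx k₁ k₂) ℂ) :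
    ‖reInner _ _ F (𝔐 l F)‖ ≤ ‖reInner (Fin r) (NoiseIdx k₁ k₂)‖ * a * ‖F‖ ^ 2 := by
  rw [reInner_comm]
  exact ((ContinuousLinearMap.le_of_opNorm_le _ (norm_reInner_le hbdd l F) F)).trans_eq (by ring)

theorem continuousOn_reInner_weighted
    (hcont : Continuous fun p : ℝ × Matrix (Fin r) (NoiseIdx k₁ k₂) ℂ => 𝔐 p.1 p.2) :
    ContinuousOn (Function.uncurry fun l F => reInner _ _ F (𝔐 l F)) (Set.univ ×ˢ Set.univ) :=
  (((reInner _ _).continuous.comp continuous_snd).clm_apply hcont).continuousOn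

theorem IsHurwitz.eventually_integrable_weightedDensity (h₀ : IsHurwitz Γ₀)
    (hsymm : ∀ l X Y, frobInner X (𝔐 l Y) = frobInner (𝔐 l X) Y)
    (hcont : Continuous fun p : ℝ × Matrix (Fin r) (NoiseIdx k₁ k₂) ℂ => 𝔐 p.1 p.2)
    (hbdd : ∀ l X, ‖𝔐 l X‖ ≤ a * ‖X‖) :
    ∀ᶠ Γ in 𝓝 Γ₀, Integrable (weightedDensity 𝔐 Γ) := by
  filter_upwards [h₀.eventually_integrable_freq (.of_forall fun _ _ => Set.mem_univ _)
    (continuousOn_reInner_weighted hcont) fun l F _ => norm_reInner_self_le hbdd l F] with Γ hΓ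
  rw [funext (weightedDensity_eq_reInner hsymm Γ)]
  exact hΓ.ofReal

theorem weightedCost_eq_integral_reInner
    (hsymm : ∀ l X Y, frobInner X (𝔐 l Y) = frobInner (𝔐 l X) Y)
    (Γ : LoopMatrices n ν k₁ k₂ r) : weightedCost 𝔐 Γ
      = 1 / (4 * Real.pi) * ∫ l, reInner _ _ (freq Γ l) (𝔐 l (freq Γ l)) := by
  rw [weightedCost, funext (weightedDensity_eq_reInner hsymm Γ), integral_complex_ofReal,
    Complex.ofReal_re]

/-- The Fréchet derivative at `Γ` of the weighted quadratic cost with the self-adjoint weighting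
operator `𝔐`. -/
noncomputable def weightedCostDeriv
    (𝔐 : ℝ → Matrix (Fin r) (NoiseIdx k₁ k₂) ℂ →ₗ[ℂ] Matrix (Fin r) (NoiseIdx k₁ k₂) ℂ)
    (Γ : LoopMatrices n ν k₁ k₂ r) : LoopMatrices n ν k₁ k₂ r →L[ℝ] ℝ :=
  (1 / (4 * Real.pi)) • ∫ l, ((2 : ℝ) • reInner _ _ (𝔐 l (freq Γ l))).comp
    (fderiv ℝ (fun Γ => freq Γ l) Γ)

theorem IsHurwitz.hasFDerivAt_weightedCost (h₀ : IsHurwitz Γ₀)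
    (hsymm : ∀ l X Y, frobInner X (𝔐 l Y) = frobInner (𝔐 l X) Y)
    (hcont : Continuous fun p : ℝ × Matrix (Fin r) (NoiseIdx k₁ k₂) ℂ => 𝔐 p.1 p.2)
    (hbdd : ∀ l X, ‖𝔐 l X‖ ≤ a * ‖X‖) :
    HasFDerivAt (weightedCost 𝔐) (weightedCostDeriv 𝔐 Γ₀) Γ₀ := by
  rw [funext (weightedCost_eq_integral_reInner hsymm)]
  refine HasFDerivAt.const_mul (h₀.hasFDerivAt_integral_freq
    (.of_forall fun _ _ => Set.mem_univ _) (fun l F _ => hasFDerivAt_reInner_self (hsymm l) F)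
    (continuousOn_reInner_weighted hcont)
    (((reInner _ _).continuous.comp hcont).const_smul (2 : ℝ)).continuousOn
    (fun l F _ => norm_reInner_self_le hbdd l F)
    (C' := 2 * (‖reInner (Fin r) (NoiseIdx k₁ k₂)‖ * a)) fun l F _ => ?_) _
  rw [norm_smul, Real.norm_two, mul_assoc]
  gcongr
  exact norm_reInner_le hbdd l F

end WeightedCost

/-! ### The risk-sensitive cost -/

section RiskSensitive

variable {θ : ℝ}

theorem freq_neg (Γ : LoopMatrices n ν k₁ k₂ r) (l : ℝ) : freq Γ (-l) = ((freq Γ l)ᴴ)ᵀ := by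
  have hreal {ι κ : Type} (M : Matrix ι κ ℝ) :
      ((M.map Complex.ofReal)ᴴ)ᵀ = M.map Complex.ofReal := by
    ext i j
    simp
  simp only [freq, transfer, Matrix.conjTranspose_mul, Matrix.transpose_mul, hreal,
    Matrix.conjTranspose_nonsing_inv, Matrix.transpose_nonsing_inv, Matrix.conjTranspose_sub,
    Matrix.transpose_sub, Matrix.conjTranspose_smul, Matrix.transpose_smul, Matrix.mul_assoc,
    Matrix.conjTranspose_one, Matrix.transpose_one]
  simp

theorem trace_specΨ_freq_neg (Γ : LoopMatrices n ν k₁ k₂ r) (l : ℝ) :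
    (specΨ (freq Γ (-l))).trace = -(specΨ (freq Γ l)).trace := by
  have hstar (F : Matrix (Fin r) (NoiseIdx k₁ k₂) ℂ) : ((((Fᴴ)ᵀ)ᴴ)ᵀ) = F := by
    ext i j
    simp
  rw [freq_neg, ← Matrix.trace_transpose, specΨ, specΨ, Matrix.transpose_mul, Matrix.transpose_mul,
    noiseJC_transpose, Matrix.transpose_transpose, hstar, Matrix.neg_mul, Matrix.mul_neg,
    Matrix.trace_neg, ← Matrix.mul_assoc]

theorem integral_trace_specΨ_freq (Γ : LoopMatrices n ν k₁ k₂ r) :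
    ∫ l, (specΨ (freq Γ l)).trace.im = 0 := by
  have h := integral_neg_eq_self (fun l => (specΨ (freq Γ l)).trace.im) volume
  simp only [trace_specΨ_freq_neg, Complex.neg_im, integral_neg] at h
  linarith

theorem exists_abs_trace_specΨ_le : ∃ c : ℝ, ∀ F : Matrix (Fin r) (NoiseIdx k₁ k₂) ℂ,
    ‖(specΨ F).trace.im‖ ≤ c * ‖F‖ ^ 2 := by
  let tr := (Matrix.traceLinearMap (Fin r) ℂ ℂ).toContinuousLinearMap
  refine ⟨‖tr‖ * ‖noiseJC k₁ k₂‖, fun F => ?_⟩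
  calc ‖(specΨ F).trace.im‖ ≤ ‖tr (specΨ F)‖ := Complex.abs_im_le_norm _
    _ ≤ ‖tr‖ * (‖F‖ * ‖noiseJC k₁ k₂‖ * ‖Fᴴ‖) :=
      tr.le_opNorm_of_le (frobenius_norm_mul_mul_le _ _ _)
    _ = ‖tr‖ * ‖noiseJC k₁ k₂‖ * ‖F‖ ^ 2 := by
      rw [Matrix.frobenius_norm_conjTranspose]
      ring

theorem IsHurwitz.eventually_integrable_trace_specΨ (h₀ : IsHurwitz Γ₀) :
    ∀ᶠ Γ in 𝓝 Γ₀, Integrable fun l => (specΨ (freq Γ l)).trace.im := by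
  obtain ⟨c, hc⟩ := exists_abs_trace_specΨ_le (k₁ := k₁) (k₂ := k₂) (r := r)
  have hcont : Continuous fun F : Matrix (Fin r) (NoiseIdx k₁ k₂) ℂ => (specΨ F).trace.im :=
    Complex.continuous_im.comp
      ((Matrix.traceLinearMap (Fin r) ℂ ℂ).toContinuousLinearMap.continuous.comp
        differentiable_specΨ.continuous)
  exact h₀.eventually_integrable_freq (.of_forall fun _ _ => Set.mem_univ _)
    (g := fun _ F => (specΨ F).trace.im) (hcont.comp continuous_snd).continuousOn
    fun _ F _ => hc F

theorem SpectralConstraint.freq_mem_posDomain (hs : SpectralConstraint θ Γ₀) (l : ℝ) :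
    freq Γ₀ l ∈ posDomain k₁ k₂ r θ :=
  have ⟨_, hρ, hspec⟩ := hs
  det_specDelta_re_pos θ _ fun x hx => (hspec l x hx).trans_lt hρ

theorem continuousOn_log_det_specDelta : ContinuousOn (fun F : Matrix (Fin r) (NoiseIdx k₁ k₂) ℂ =>
    Real.log (specDelta θ F).det.re) (posDomain k₁ k₂ r θ) := fun _ hF =>
  (hasFDerivAt_log_det_specDelta θ hF).continuousAt.continuousWithinAt

theorem exists_norm_weighting_le {K : Set (Matrix (Fin r) (NoiseIdx k₁ k₂) ℂ)} (hK : IsCompact K)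
    (hKU : K ⊆ posDomain k₁ k₂ r θ) : ∃ a : ℝ, ∀ F ∈ K, ∀ X, ‖weighting θ F X‖ ≤ a * ‖X‖ := by
  obtain ⟨a, ha⟩ := hK.exists_bound_of_continuousOn ((continuousOn_weightingL θ).mono hKU)
  exact ⟨a, fun F hF X => (weightingL θ F).le_of_opNorm_le (ha F hF) X⟩

theorem IsHurwitz.exists_isCompact_subset_posDomain (h₀ : IsHurwitz Γ₀)
    (hs : SpectralConstraint θ Γ₀) : ∃ K, IsCompact K ∧ K ⊆ posDomain k₁ k₂ r θ ∧
      ∀ᶠ Γ in 𝓝 Γ₀, ∀ l, freq Γ l ∈ K :=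
  h₀.exists_isCompact_freq_mem (isOpen_posDomain θ) (zero_mem_posDomain θ) hs.freq_mem_posDomain

theorem IsHurwitz.exists_norm_weighting_freq_le (h₀ : IsHurwitz Γ₀)
    (hs : SpectralConstraint θ Γ₀) :
    ∃ a : ℝ, ∀ l X, ‖weighting θ (freq Γ₀ l) X‖ ≤ a * ‖X‖ := by
  obtain ⟨K, hKc, hKU, hK⟩ := h₀.exists_isCompact_subset_posDomain hs
  obtain ⟨a, ha⟩ := exists_norm_weighting_le hKc hKU
  exact ⟨a, fun l => ha _ (hK.self_of_nhds l)⟩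

theorem IsHurwitz.continuous_weighting_freq (h₀ : IsHurwitz Γ₀) (hs : SpectralConstraint θ Γ₀) :
    Continuous fun p : ℝ × Matrix (Fin r) (NoiseIdx k₁ k₂) ℂ =>
      weighting θ (freq Γ₀ p.1) p.2 :=
  (((continuousOn_weightingL θ).comp_continuous (continuous_freq h₀.isRegularFreq)
    hs.freq_mem_posDomain).comp continuous_fst).clm_apply continuous_snd

theorem IsHurwitz.eventually_integrable_log_det (h₀ : IsHurwitz Γ₀)
    (hs : SpectralConstraint θ Γ₀) :
    ∀ᶠ Γ in 𝓝 Γ₀, Integrable fun l => Real.log (specDelta θ (freq Γ l)).det.re := by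
  obtain ⟨K, hKc, hKU, hK⟩ := h₀.exists_isCompact_subset_posDomain hs
  obtain ⟨c, hc⟩ := exists_abs_log_det_le θ hKc hKU
  exact h₀.eventually_integrable_freq hK (g := fun _ F => Real.log (specDelta θ F).det.re)
    ((continuousOn_log_det_specDelta.mono hKU).comp continuousOn_snd fun _ h => h.2)
    fun _ F hF => hc F hF

theorem IsHurwitz.hasFDerivAt_integral_log_det (h₀ : IsHurwitz Γ₀)
    (hs : SpectralConstraint θ Γ₀) :
    HasFDerivAt (fun Γ => ∫ l, Real.log (specDelta θ (freq Γ l)).det.re)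
      (∫ l, (-(2 * θ) • reInner _ _ (weighting θ (freq Γ₀ l) (freq Γ₀ l))).comp
        (fderiv ℝ (fun Γ => freq Γ l) Γ₀)) Γ₀ := by
  obtain ⟨K, hKc, hKU, hK⟩ := h₀.exists_isCompact_subset_posDomain hs
  obtain ⟨c, hc⟩ := exists_abs_log_det_le θ hKc hKU
  obtain ⟨a, ha⟩ := exists_norm_weighting_le hKc hKU
  refine h₀.hasFDerivAt_integral_freq hK (g := fun _ F => Real.log (specDelta θ F).det.re)
    (g' := fun _ F => -(2 * θ) • reInner _ _ (weighting θ F F))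
    (C' := |2 * θ| * (‖reInner (Fin r) (NoiseIdx k₁ k₂)‖ * a))
    (fun _ F hF => hasFDerivAt_log_det_specDelta θ (hKU hF))
    ((continuousOn_log_det_specDelta.mono hKU).comp continuousOn_snd fun _ h => h.2) ?_
    (fun _ F hF => hc F hF) fun _ F hF => ?_
  · have hweighting : ContinuousOn (fun F => weightingL θ F F) K :=
      ((continuousOn_weightingL θ).mono hKU).clm_apply continuousOn_id
    exact (((reInner _ _).continuous.comp_continuousOn hweighting).const_smul (-(2 * θ))).comp
      continuousOn_snd fun _ h => h.2
  · rw [norm_smul, norm_neg, Real.norm_eq_abs, mul_assoc, mul_assoc]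
    gcongr
    exact (reInner _ _).le_opNorm_of_le (ha F hF F)

theorem IsHurwitz.eventually_logDetD_eq (h₀ : IsHurwitz Γ₀) (hs : SpectralConstraint θ Γ₀) :
    ∀ᶠ Γ in 𝓝 Γ₀, logDetD θ Γ = fun l =>
      Real.log (specDelta θ (freq Γ l)).det.re + θ * (specΨ (freq Γ l)).trace.im := by
  obtain ⟨K, -, hKU, hK⟩ := h₀.exists_isCompact_subset_posDomain hs
  filter_upwards [hK] with Γ hΓ
  exact funext fun l => log_det_specD θ _ (hKU (hΓ l))

theorem IsHurwitz.eventually_integrable_logDetD (h₀ : IsHurwitz Γ₀)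
    (hs : SpectralConstraint θ Γ₀) : ∀ᶠ Γ in 𝓝 Γ₀, Integrable (logDetD θ Γ) := by
  filter_upwards [h₀.eventually_logDetD_eq hs, h₀.eventually_integrable_log_det hs,
    h₀.eventually_integrable_trace_specΨ] with Γ hΓ hdet htr
  rw [hΓ]
  exact hdet.add (htr.const_mul θ)

theorem IsHurwitz.eventually_qefRate_eq (h₀ : IsHurwitz Γ₀) (hs : SpectralConstraint θ Γ₀) :
    ∀ᶠ Γ in 𝓝 Γ₀, qefRate θ Γ
      = -(1 / (4 * Real.pi)) * ∫ l, Real.log (specDelta θ (freq Γ l)).det.re := by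
  filter_upwards [h₀.eventually_logDetD_eq hs, h₀.eventually_integrable_log_det hs,
    h₀.eventually_integrable_trace_specΨ] with Γ hΓ hdet htr
  rw [qefRate, hΓ, integral_add hdet (htr.const_mul θ), integral_const_mul,
    integral_trace_specΨ_freq, mul_zero, add_zero]

theorem IsHurwitz.hasFDerivAt_qefRate (h₀ : IsHurwitz Γ₀) (hs : SpectralConstraint θ Γ₀) :
    HasFDerivAt (qefRate θ)
      (θ • weightedCostDeriv (fun l => weighting θ (freq Γ₀ l)) Γ₀) Γ₀ := by
  refine (((h₀.hasFDerivAt_integral_log_det hs).const_mul _).congr_of_eventuallyEq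
    (h₀.eventually_qefRate_eq hs)).congr_fderiv ?_
  simp only [neg_smul, mul_comm 2 θ, mul_smul, ContinuousLinearMap.smul_comp, integral_smul,
    weightedCostDeriv, smul_neg, neg_neg]
  exact smul_comm _ θ _

end RiskSensitive

end Integrals

/-! ### Gradients and stationary points -/

section Gradients

theorem matGrad_comp_eq_smul {ι κ E : Type*} [Fintype ι] [Fintype κ] [DecidableEq ι]
    [DecidableEq κ] [NormedAddCommGroup E] [NormedSpace ℝ E] {g : Matrix ι κ ℝ → E}
    {X : Matrix ι κ ℝ} (hg : DifferentiableAt ℝ g X) {f₁ f₂ : E → ℝ} {θ : ℝ} {L : E →L[ℝ] ℝ}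
    (h₁ : HasFDerivAt f₁ (θ • L) (g X)) (h₂ : HasFDerivAt f₂ L (g X)) :
    matGrad (fun X => f₁ (g X)) X = θ • matGrad (fun X => f₂ (g X)) X := by
  have hfderiv : fderiv ℝ (fun X => f₁ (g X)) X = θ • fderiv ℝ (fun X => f₂ (g X)) X :=
    (h₁.comp X hg.hasFDerivAt).fderiv.trans
      (congrArg (θ • ·) (h₂.comp X hg.hasFDerivAt).fderiv.symm)
  ext i j
  exact congrArg (fun L => L (Matrix.single i j 1)) hfderiv

variable {n ν k₁ k₂ q₁ q₂ r : ℕ} {cost₁ cost₂ : LoopMatrices n ν k₁ k₂ r → ℝ}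
  {L : LoopMatrices n ν k₁ k₂ r →L[ℝ] ℝ} {θ : ℝ} (P : Setup n ν k₁ k₂ q₁ q₂ r)
  {ε : Energetics ν k₂ q₁}

theorem loopGrad_eq_smul {Γ : LoopMatrices n ν k₁ k₂ r} (h₁ : HasFDerivAt cost₁ (θ • L) Γ)
    (h₂ : HasFDerivAt cost₂ L Γ) : loopGrad cost₁ Γ = θ • loopGrad cost₂ Γ :=
  Prod.ext (matGrad_comp_eq_smul (g := fun X => (X, Γ.2.1, Γ.2.2)) (by fun_prop) h₁ h₂)
    (Prod.ext (matGrad_comp_eq_smul (g := fun X => (Γ.1, X, Γ.2.2)) (by fun_prop) h₁ h₂)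
      (matGrad_comp_eq_smul (g := fun X => (Γ.1, Γ.2.1, X)) (by fun_prop) h₁ h₂))

theorem differentiable_loop : Differentiable ℝ P.loop := by
  have hc : Differentiable ℝ fun γ : CtrlMatrices ν k₂ q₁ q₂ => γ.2.2.1 := by fun_prop
  have he : Differentiable ℝ fun γ : CtrlMatrices ν k₂ q₁ q₂ => γ.2.2.2 := by fun_prop
  have hconst {ι κ : Type} [Fintype ι] [Fintype κ] (X : Matrix ι κ ℝ) :
      Differentiable ℝ fun _ : CtrlMatrices ν k₂ q₁ q₂ => X := differentiable_const X
  exact (differentiable_fromBlocks (hconst _) (differentiable_matrix_mul (hconst _) hc)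
      (differentiable_matrix_mul he (hconst _)) differentiable_fst).prodMk
    ((differentiable_fromBlocks (hconst _) (hconst _) (differentiable_matrix_mul he (hconst _))
      differentiable_snd.fst).prodMk
    (differentiable_fromCols (hconst _) (differentiable_matrix_mul (hconst _) hc)))

theorem ctrlGrad_eq_smul {γ : CtrlMatrices ν k₂ q₁ q₂} (h₁ : HasFDerivAt cost₁ (θ • L) (P.loop γ))
    (h₂ : HasFDerivAt cost₂ L (P.loop γ)) : ctrlGrad P cost₁ γ = θ • ctrlGrad P cost₂ γ := by
  have hpartial {ι κ : Type} [Fintype ι] [Fintype κ] [DecidableEq ι] [DecidableEq κ]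
      (g : Matrix ι κ ℝ → CtrlMatrices ν k₂ q₁ q₂) (hg : Differentiable ℝ g) (X : Matrix ι κ ℝ)
      (hX : g X = γ) : matGrad (fun X => cost₁ (P.loop (g X))) X
        = θ • matGrad (fun X => cost₂ (P.loop (g X))) X :=
    matGrad_comp_eq_smul (g := fun X => P.loop (g X)) (L := L)
      ((differentiable_loop P).comp hg X) (by rwa [hX]) (by rwa [hX])
  exact Prod.ext (hpartial (fun X => (X, γ.2)) (by fun_prop) _ rfl)
    (Prod.ext (hpartial (fun X => (γ.1, X, γ.2.2)) (by fun_prop) _ rfl)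
      (Prod.ext (hpartial (fun X => (γ.1, γ.2.1, X, γ.2.2.2)) (by fun_prop) _ rfl)
        (hpartial (fun X => (γ.1, γ.2.1, γ.2.2.1, X)) (by fun_prop) _ rfl)))

theorem isStationaryController_iff_of_ctrlGrad_eq_smul (hθ : θ ≠ 0)
    (h : ctrlGrad P cost₁ (P.ctrl ε) = θ • ctrlGrad P cost₂ (P.ctrl ε)) :
    IsStationaryController P cost₁ ε ↔ IsStationaryController P cost₂ ε := by
  simp only [IsStationaryController, h]
  simp only [Prod.smul_fst, Prod.smul_snd, symPart, antisymPart, Matrix.mul_smul, Matrix.smul_mul,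
    Matrix.transpose_smul, smul_comm _ θ, ← smul_add, ← smul_sub, smul_eq_zero_iff_right hθ]

theorem differentiable_ctrl :
    Differentiable ℝ (P.ctrl : Energetics ν k₂ q₁ → CtrlMatrices ν k₂ q₁ q₂) := by
  have hmul {ι κ μ : Type} [Fintype ι] [Fintype κ] [Fintype μ]
      (X : Matrix ι κ ℝ) {Y : Energetics ν k₂ q₁ → Matrix κ μ ℝ} (hY : Differentiable ℝ Y) :
      Differentiable ℝ fun ε => (2 : ℝ) • (X * Y ε) :=
    (differentiable_matrix_mul (differentiable_const _) hY).fun_const_smul 2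
  have htranspose {ι κ : Type} [Fintype ι] [Fintype κ] {Y : Energetics ν k₂ q₁ → Matrix ι κ ℝ}
      (hY : Differentiable ℝ Y) : Differentiable ℝ fun ε => (Y ε)ᵀ :=
    differentiable_matrix.2 fun i j => differentiable_matrix.1 hY j i
  have hquad {ι κ : Type} [Fintype ι] [Fintype κ] (X : Matrix ι ι ℝ)
      {Y : Energetics ν k₂ q₁ → Matrix ι κ ℝ} (hY : Differentiable ℝ Y) :
      Differentiable ℝ fun ε => (Y ε)ᵀ * X * Y ε :=
    differentiable_matrix_mul (differentiable_matrix_mul (htranspose hY)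
      (differentiable_const _)) hY
  let toR₂ : Energetics ν k₂ q₁ →ₗ[ℝ] Matrix (Fin ν) (Fin ν) ℝ :=
    (symMat ν).subtype ∘ₗ LinearMap.fst ℝ _ _
  have hR : Differentiable ℝ toR₂ := toR₂.toContinuousLinearMap.differentiable
  have hM : Differentiable ℝ fun ε : Energetics ν k₂ q₁ => ε.2.1 := differentiable_snd.fst
  have hL : Differentiable ℝ fun ε : Energetics ν k₂ q₁ => ε.2.2 := differentiable_snd.snd
  exact (hmul _ ((hR.add (hquad _ hM)).add (hquad _ hL))).prodMk
    ((hmul _ (htranspose hM)).prodMk ((hmul _ hM).prodMk (hmul _ (htranspose hL))))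

theorem differentiable_closedLoop :
    Differentiable ℝ (P.closedLoop : Energetics ν k₂ q₁ → LoopMatrices n ν k₁ k₂ r) :=
  (differentiable_loop P).comp (differentiable_ctrl P)

theorem fderiv_comp_closedLoop_eq_zero_iff (hθ : θ ≠ 0)
    (h₁ : HasFDerivAt cost₁ (θ • L) (P.closedLoop ε))
    (h₂ : HasFDerivAt cost₂ L (P.closedLoop ε)) :
    fderiv ℝ (fun ε' => cost₁ (P.closedLoop ε')) ε = 0 ↔
      fderiv ℝ (fun ε' => cost₂ (P.closedLoop ε')) ε = 0 := by
  have hloop := (differentiable_closedLoop P ε).hasFDerivAt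
  have e₁ : fderiv ℝ (fun ε' => cost₁ (P.closedLoop ε')) ε = _ := (h₁.comp ε hloop).fderiv
  have e₂ : fderiv ℝ (fun ε' => cost₂ (P.closedLoop ε')) ε = _ := (h₂.comp ε hloop).fderiv
  rw [e₁, e₂, ContinuousLinearMap.smul_comp, smul_eq_zero_iff_right hθ]

end Gradients

theorem theorem6p1_general {n ν k₁ k₂ q₁ q₂ r : ℕ} (P : Setup n ν k₁ k₂ q₁ q₂ r) {θ : ℝ}
    (hθ : θ ≠ 0) {ε : Energetics ν k₂ q₁} (hε : IsHurwitz (P.closedLoop ε))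
    (hs : SpectralConstraint θ (P.closedLoop ε))
    (𝔐 : ℝ → Matrix (Fin r) (NoiseIdx k₁ k₂) ℂ →ₗ[ℂ] Matrix (Fin r) (NoiseIdx k₁ k₂) ℂ)
    (h𝔐 : 𝔐 = fun l => weighting θ (freq (P.closedLoop ε) l)) :
    (∀ l X Y, frobInner X (𝔐 l Y) = frobInner (𝔐 l X) Y) ∧
    (∃ c : ℝ, ∀ l X, frobNorm (𝔐 l X) ≤ c * frobNorm X) ∧
    (∀ᶠ Γ in 𝓝 (P.closedLoop ε),
      Integrable (logDetD θ Γ) ∧ Integrable (weightedDensity 𝔐 Γ)) ∧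
    DifferentiableAt ℝ (qefRate θ) (P.closedLoop ε) ∧
    DifferentiableAt ℝ (weightedCost 𝔐) (P.closedLoop ε) ∧
    θ⁻¹ • loopGrad (qefRate θ) (P.closedLoop ε) = loopGrad (weightedCost 𝔐) (P.closedLoop ε) ∧
    (IsStationaryController P (qefRate θ) ε ↔ IsStationaryController P (weightedCost 𝔐) ε) ∧
    (fderiv ℝ (fun ε' => qefRate θ (P.closedLoop ε')) ε = 0 ↔
      fderiv ℝ (fun ε' => weightedCost 𝔐 (P.closedLoop ε')) ε = 0) := by
  subst h𝔐
  have hsymm l := frobInner_weighting θ (freq (P.closedLoop ε) l)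
  have hcont := hε.continuous_weighting_freq hs
  obtain ⟨a, hbdd⟩ := hε.exists_norm_weighting_freq_le hs
  have hU := hε.hasFDerivAt_qefRate hs
  have hV := hε.hasFDerivAt_weightedCost hsymm hcont hbdd
  refine ⟨hsymm, ⟨a, by simpa only [frobNorm_eq_norm] using hbdd⟩,
    (hε.eventually_integrable_logDetD hs).and
      (hε.eventually_integrable_weightedDensity hsymm hcont hbdd),
    hU.differentiableAt, hV.differentiableAt, ?_,
    isStationaryController_iff_of_ctrlGrad_eq_smul P hθ (ctrlGrad_eq_smul P hU hV),
    fderiv_comp_closedLoop_eq_zero_iff P hθ hU hV⟩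
  rw [loopGrad_eq_smul hU hV, inv_smul_smul₀ hθ]

end FrobeniusTopology

end CQRS

theorem theorem6p1 {n ν k₁ k₂ q₁ q₂ r : ℕ} (P : Setup n ν k₁ k₂ q₁ q₂ r)
    (θ : ℝ) (hθ : 0 < θ) (ε : Energetics ν k₂ q₁) (hε : Admissible P θ ε)
    (𝔐 : ℝ → Matrix (Fin r) (NoiseIdx k₁ k₂) ℂ →ₗ[ℂ] Matrix (Fin r) (NoiseIdx k₁ k₂) ℂ)
    (h𝔐 : 𝔐 = fun l => weighting θ (freq (P.closedLoop ε) l)) :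
    -- the weighting operator is self-adjoint and uniformly bounded over the frequency
    (∀ l X Y, frobInner X (𝔐 l Y) = frobInner (𝔐 l X) Y) ∧
    (∃ c : ℝ, ∀ l X, frobNorm (𝔐 l X) ≤ c * frobNorm X) ∧
    -- near the closed-loop system, both cost integrals converge
    (∀ᶠ Γ in 𝓝 (P.closedLoop ε),
      Integrable (logDetD θ Γ) ∧ Integrable (weightedDensity 𝔐 Γ)) ∧
    -- both costs are Frechet differentiable there as functions of the system matrices
    DifferentiableAt ℝ (qefRate θ) (P.closedLoop ε) ∧
    DifferentiableAt ℝ (weightedCost 𝔐) (P.closedLoop ε) ∧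
    -- the core matrices `θ⁻¹ ∂_Γ Υ_θ` and `∂_Γ V` coincide
    θ⁻¹ • loopGrad (qefRate θ) (P.closedLoop ε) = loopGrad (weightedCost 𝔐) (P.closedLoop ε) ∧
    -- the two problems have the same first-order optimality conditions at the controller
    (IsStationaryController P (qefRate θ) ε ↔ IsStationaryController P (weightedCost 𝔐) ε) ∧
    -- equivalently, the derivatives with respect to `(R₂, M₂, L₂)` vanish simultaneously
    (fderiv ℝ (fun ε' => qefRate θ (P.closedLoop ε')) ε = 0 ↔
      fderiv ℝ (fun ε' => weightedCost 𝔐 (P.closedLoop ε')) ε = 0) :=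
  theorem6p1_general P hθ.ne' hε.hurwitz hε.spectral 𝔐 h𝔐
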